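/- **Setting.** Let $n_0\ge 1$ and $\mathcal X=\{x\in\mathbb R^{n_0}:\|x\|=\sqrt{n_0}\}$, and let $\phi:\mathbb R\to\mathbb R$ be Lipschitz. For a width $n$, consider the stochastic network with one hidden layer $$F(x)=\frac1{\sqrt n}\sum_{j=1}^n W^2_j\,\phi(U^1_j(x)),\qquad U^1_j(x)=\frac1{\sqrt{n_0}}\sum_{k=1}^{n_0}W^1_{jk}x_k ,$$ whose weights $W=(W^1,W^2)$ have law $\mathcal N(\mathfrak m,\mathrm{Id})$, that is, they are independent Gaussian variables with unit variances and trainable means $\mathfrak m=(\mathfrak m^1,\mathfrak m^2)$. Let $Q^2(x)=\operatorname{Var}_{W\sim\mathcal N(\mathfrak m,\mathrm{Id})}[F(x)]$ be the output variance for given $\mathfrak m$. With $\zeta\sim\mathcal N(0,1)$, set $$\psi(u)=\mathbb E[\phi(\zeta+u)],\qquad \xi(u)=\mathbb E[\phi(\zeta+u)^2],\qquad \sigma^2=2\,\mathbb E[\xi(\zeta)]-\mathbb E[\psi(\zeta)^2],\quad \sigma\ge 0 .$$ Let $M^1_j(x)=\frac1{\sqrt{n_0}}\sum_k \mathfrak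 m^1_{jk}x_k$ and $M^2(x)=\frac1{\sqrt n}\sum_j\mathfrak m^2_j\psi(M^1_j(x))$. Fix a sample $s=((x_i,y_i))_{i\le m}$, $m\ge1$, with $x_i\in\mathcal X$ and $y_i\in\{\pm1\}$, a number $\eta>0$, and a loss $\hat\ell:\mathbb R\times\{\pm1\}\to[0,\infty)$ that is measurable in its first argument, with $\hat\ell(u,y)\le Ke^{\kappa|u|}$ for some constants $K,\kappa$. For every $n$, the entries of $\mathfrak m(0)$ are independent draws from $\mathcal N(0,1)$, and for all large $n$ the means are trained, almost surely, by the gradient flow $\partial_t\mathfrak m(t)=-\nabla\mathcal C_s(\mathfrak m(t))$, $t\ge0$, of the PAC-Bayesian objective $$\mathcal C_s(\mathfrak m)=\bar{\mathcal L}_s(\mathfrak m)+\frac1{2\eta\sqrt{8m}}\|\mathfrak m-\mathfrak m(0)\|_F^2 .$$ Here $\bar{\mathcal L}_s$ is either (for all large $n$) the expected empirical loss $\mathbb E_{W\sim\mathcal N(\mathfrak m,\mathrm{Id})}\big[\frac1m\sum_i\hat\ell(F(x_i),y_i)\big]$, or (for all large $n$) its infinite-width form $\frac1m\sum_i\mathbb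 E_{\zeta\sim\mathcal N(0,1)}[\hat\ell(\sigma\zeta+M^2(x_i),y_i)]$. Write $Q^2(x;t)$ for the output variance at $\mathfrak m=\mathfrak m(t)$ and $\Delta Q^2(x;t)=Q^2(x;t)-Q^2(x;0)$. Probabilities are with respect to the random initialisation. **Result.** 1. For every $n$, $\mathfrak m$ and $x\in\mathcal X$, $$Q^2(x)=\frac1n\sum_{j=1}^n\big(1+(\mathfrak m^2_j)^2\big)\,\xi(M^1_j(x))-\frac1n\sum_{j=1}^n(\mathfrak m^2_j)^2\,\psi(M^1_j(x))^2 .$$ 2. At initialisation the variance is asymptotically deterministic and independent of the input: for every $x\in\mathcal X$, $Q^2(x;0)\to\sigma^2$ in probability as $n\to\infty$. 3. During training it changes by $O(1/\sqrt n)$ in probability, uniformly in $x$ and $t$: for every $\varepsilon>0$ there is a constant $C$ such that, for all large $n$, $$\mathbb P\Big(\exists\,x\in\mathcal X,\ t\ge0:\ |\Delta Q^2(x;t)|>C/\sqrt n\Big)\le\varepsilon .$$ 4. Consequently the variance stays equal to $\sigma^2$ in the limit: for every $x\in\mathcal X$ and $\delta>0$, $\mathbb P\big(\exists\,t\ge0:\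 |Q^2(x;t)-\sigma^2|\ge\delta\big)\to0$ as $n\to\infty$. -/

import Mathlib

open MeasureTheory ProbabilityTheory Filter Topology
open scoped NNReal ENNReal

namespace WideStochasticNet

noncomputable section

/-- Indices of the parameters of a network with one hidden layer of width `n` and input dimension
`n₀`: `Sum.inl (j, k)` is the entry `(j, k)` of the first layer, `Sum.inr j` the `j`-th entry of the
second layer. -/
abbrev Idx (n₀ n : ℕ) : Type := (Fin n × Fin n₀) ⊕ Fin n

/-- The space of the trainable means `𝔪 = (𝔪¹, 𝔪²)`; its norm is the Frobenius norm. -/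
abbrev Params (n₀ n : ℕ) : Type := EuclideanSpace ℝ (Idx n₀ n)

/-- The pre-activation `U¹_j(x) = n₀^{-1/2} ∑ₖ W¹_{jk} xₖ` of the hidden layer. -/
def hidden {n₀ n : ℕ} (W : Idx n₀ n → ℝ) (x : EuclideanSpace ℝ (Fin n₀)) (j : Fin n) : ℝ :=
  (1 / √(n₀ : ℝ)) * ∑ k, W (Sum.inl (j, k)) * x k

/-- The output `n^{-1/2} ∑ⱼ W²_j φ(U¹_j(x))` of the network with activation `φ`, weights `W`. -/
def output {n₀ n : ℕ} (φ : ℝ → ℝ) (W : Idx n₀ n → ℝ) (x : EuclideanSpace ℝ (Fin n₀)) : ℝ :=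
  (1 / √(n : ℝ)) * ∑ j, W (Sum.inr j) * φ (hidden W x j)

/-- The law `N(𝔪, Id)` of the stochastic weights: independent entries, means `𝔪`, variances `1`. -/
def weightLaw {n₀ n : ℕ} (θ : Params n₀ n) : Measure (Idx n₀ n → ℝ) :=
  Measure.pi fun i => gaussianReal (θ i) 1

/-- The output variance `Q²(x)`: the variance of the stochastic network's output at `x`, with
respect to the randomness of the weights `W ∼ N(𝔪, Id)`, the means `𝔪` being fixed. -/
def outputVariance {n₀ n : ℕ} (φ : ℝ → ℝ) (θ : Params n₀ n) (x : EuclideanSpace ℝ (Fin n₀)) : ℝ :=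
  variance (fun W => output φ W x) (weightLaw θ)

/-- `ψ(u) = 𝔼[φ(ζ + u)]`, `ζ ∼ N(0,1)`. -/
def psi (φ : ℝ → ℝ) (u : ℝ) : ℝ := ∫ z, φ (z + u) ∂(gaussianReal 0 1)

/-- `ξ(u) = 𝔼[φ(ζ + u)²]`, `ζ ∼ N(0,1)`. -/
def xi (φ : ℝ → ℝ) (u : ℝ) : ℝ := ∫ z, φ (z + u) ^ 2 ∂(gaussianReal 0 1)

/-- The constant `σ² = 2 𝔼[ξ(ζ)] - 𝔼[ψ(ζ)²]`, `ζ ∼ N(0,1)`. -/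
def sigmaSq (φ : ℝ → ℝ) : ℝ :=
  2 * (∫ z, xi φ z ∂(gaussianReal 0 1)) - ∫ z, psi φ z ^ 2 ∂(gaussianReal 0 1)

/-- The expected empirical loss `𝔼_{W ∼ N(𝔪, Id)}[𝓛ₛ(W)]` of the stochastic network on the data
`(X i, Y i)`, where `𝓛ₛ(W)` is the average over `i` of `ℓ (F(X i)) (Y i)`. -/
def expectedLoss {n₀ n m : ℕ} (φ : ℝ → ℝ) (ℓ : ℝ → ℤˣ → ℝ)
    (X : Fin m → EuclideanSpace ℝ (Fin n₀)) (Y : Fin m → ℤˣ) (θ : Params n₀ n) : ℝ :=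
  ∫ W, (1 / (m : ℝ)) * ∑ i, ℓ (output φ W (X i)) (Y i) ∂(weightLaw θ)

/-- The closed form that the expected empirical loss takes in the infinite-width limit: the average
over `i` of `𝔼[ℓ (σ ζ + M²(X i)) (Y i)]`, `ζ ∼ N(0,1)`, where `M²` is the output of the
deterministic network with activation `ψ` and parameters `𝔪`. -/
def limitLoss {n₀ n m : ℕ} (φ : ℝ → ℝ) (ℓ : ℝ → ℤˣ → ℝ)
    (X : Fin m → EuclideanSpace ℝ (Fin n₀)) (Y : Fin m → ℤˣ) (θ : Params n₀ n) : ℝ :=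
  (1 / (m : ℝ)) *
    ∑ i, ∫ z, ℓ (√(sigmaSq φ) * z + output (psi φ) θ (X i)) (Y i) ∂(gaussianReal 0 1)

/-- The PAC-Bayesian training objective `𝓛(𝔪) + ‖𝔪 - 𝔪(0)‖² / (2 η √(8 m))`. -/
def pacObjective {n₀ n : ℕ} (L : Params n₀ n → ℝ) (η : ℝ) (m : ℕ) (θ₀ θ : Params n₀ n) : ℝ :=
  L θ + 1 / (2 * η * √(8 * (m : ℝ))) * ‖θ - θ₀‖ ^ 2

/-- `θ` solves the gradient flow `∂ₜ θ(t) = -∇C(θ(t))` on `[0, ∞)` (at `t = 0` the derivative is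
the right one); `C` has to be differentiable along the trajectory. -/
def IsGradientFlow {n₀ n : ℕ} (C : Params n₀ n → ℝ) (θ : ℝ → Params n₀ n) : Prop :=
  ∀ t : ℝ, 0 ≤ t → ∃ g : Params n₀ n,
    HasGradientAt C g (θ t) ∧ HasDerivWithinAt θ (-g) (Set.Ici 0) t

end

end WideStochasticNet

open WideStochasticNet

/-!
The proof is elementary once the output variance is written as an average over the hidden neurons.

Since `‖x‖² = n₀`, the pairs `(W²_j, U¹_j(x))` are independent over `j`, with independent Gaussian
components of unit variance (`measurePreserving_neurons`). The variance of the output is therefore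
the average of the variances of the `W²_j φ(U¹_j(x))`, which is the finite-width formula
(`outputVariance_eq`); at initialisation the average is over i.i.d. square-integrable variables of
mean `σ²`, and Chebyshev's inequality gives the limit in probability
(`tendstoInMeasure_outputVariance`).

Training is lazy for two reasons. First, the objective decreases along the gradient flow and the
loss is non-negative, so that `‖𝔪(t) - 𝔪(0)‖²` is at most a constant multiple of the initial loss, at all
times (`norm_sub_sq_le_of_isGradientFlow`). The initial loss is tight in `n`: by the exponential
growth of `ℓ`, its expectation is bounded by the exponential moments of the output of a network with
centered Gaussian weights, and these are bounded in the width because the output is conditionally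
Gaussian given its first layer (`exists_lintegral_exp_abs_output_le`). For the expected empirical
loss the weights have variance `2`, the sum of the variances of the initial means and of the
stochastic fluctuations; for the infinite-width loss the activation is `ψ` and the variance `1`.

Second, a neuron with means `(a, u)` contributes `ψ(u)² + (1 + a²) (ξ(u) - ψ(u)²)` to the variance.
The function `ψ` is Lipschitz, and `ξ - ψ²`, the variance of `φ(ζ + u)`, is bounded and Lipschitz. A
displacement of the means of norm `O(1)` thus changes the sum of the `n` contributions by `O(√n)`,
hence their average by `O(1/√n)`, uniformly in the input (`exists_abs_outputVariance_sub_le`).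
-/

namespace WideStochasticNet

/-! ### The joint law of the hidden neurons -/

theorem measurable_hidden {n₀ n : ℕ} (x : EuclideanSpace ℝ (Fin n₀)) (j : Fin n) :
    Measurable fun W : Idx n₀ n → ℝ => hidden W x j := by
  unfold hidden
  fun_prop

theorem measurePreserving_curry {ι κ : Type*} [Fintype ι] [Fintype κ] (ν : ι × κ → Measure ℝ)
    [∀ p, IsProbabilityMeasure (ν p)] :
    MeasurePreserving (fun (w : ι × κ → ℝ) i k => w (i, k)) (Measure.pi ν)
      (Measure.pi fun i => Measure.pi fun k => ν (i, k)) := by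
  refine ⟨by fun_prop, ?_⟩
  have h := Measure.infinitePi_map_curry (X := ℝ) fun i k => ν (i, k)
  simp only [Measure.infinitePi_eq_pi] at h
  exact h

/-- A normalised linear form of independent Gaussian variables of common variance is a Gaussian
variable of the same variance. -/
theorem measurePreserving_preactivation {n₀ : ℕ} (hn₀ : 0 < n₀) {x : EuclideanSpace ℝ (Fin n₀)}
    (hx : ‖x‖ = √(n₀ : ℝ)) (a : Fin n₀ → ℝ) (v : ℝ≥0) :
    MeasurePreserving (fun w : Fin n₀ → ℝ => (1 / √(n₀ : ℝ)) * ∑ k, w k * x k)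
      (Measure.pi fun k => gaussianReal (a k) v)
      (gaussianReal ((1 / √(n₀ : ℝ)) * ∑ k, a k * x k) v) := by
  set P := Measure.pi fun k => gaussianReal (a k) v
  have hsum : ∑ k, x k ^ 2 = (n₀ : ℝ) := by
    rw [← EuclideanSpace.real_norm_sq_eq, hx, Real.sq_sqrt (by positivity)]
  have hn : (n₀ : ℝ) ≠ 0 := by positivity
  have hmem : ∀ k, MemLp (fun y : ℝ => (1 / √(n₀ : ℝ)) * x k * y) 2 (gaussianReal (a k) v) :=
    fun k => IsGaussian.memLp_two_id.const_mul _
  have heq : (fun w : Fin n₀ → ℝ => (1 / √(n₀ : ℝ)) * ∑ k, w k * x k)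
      = fun w => ∑ k, (1 / √(n₀ : ℝ)) * x k * w k := by
    ext w; rw [Finset.mul_sum]; exact Finset.sum_congr rfl fun k _ => by ring
  have hind : iIndepFun (fun k (w : Fin n₀ → ℝ) => (1 / √(n₀ : ℝ)) * x k * w k) P :=
    iIndepFun_pi (X := fun k y => (1 / √(n₀ : ℝ)) * x k * y) fun k => by fun_prop
  have hG : HasGaussianLaw (fun w : Fin n₀ → ℝ => ∑ k, (1 / √(n₀ : ℝ)) * x k * w k) P := by
    refine iIndepFun.hasGaussianLaw_fun_sum (fun k => ?_) hind
    have h1 : HasGaussianLaw (fun w : Fin n₀ → ℝ => w k) P :=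
      (measurePreserving_eval (fun k => gaussianReal (a k) v) k).hasLaw.hasGaussianLaw
    simpa using h1.fun_smul ((1 / √(n₀ : ℝ)) * x k)
  have hmean : ∫ w, ∑ k, (1 / √(n₀ : ℝ)) * x k * w k ∂P
      = (1 / √(n₀ : ℝ)) * ∑ k, a k * x k := by
    rw [integral_finsetSum, Finset.mul_sum]
    · refine Finset.sum_congr rfl fun k _ => ?_
      rw [integral_const_mul]
      have := (measurePreserving_eval (fun k => gaussianReal (a k) v) k).hasLaw.integral_eq
      simp only [Function.eval] at this
      rw [this, integral_id_gaussianReal]; ring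
    · intro k _
      exact ((hmem k).comp_measurePreserving (measurePreserving_eval
        (fun k => gaussianReal (a k) v) k)).integrable (by norm_num)
  have hvar : Var[fun w : Fin n₀ → ℝ => ∑ k, (1 / √(n₀ : ℝ)) * x k * w k; P] = v := by
    have h := variance_sum_pi hmem
    have h2 : (∑ k, fun w : Fin n₀ → ℝ => (1 / √(n₀ : ℝ)) * x k * w k)
      = fun w => ∑ k, (1 / √(n₀ : ℝ)) * x k * w k := by ext w; simp
    rw [h2] at h
    rw [h]
    have : ∀ k, Var[fun y : ℝ => (1 / √(n₀ : ℝ)) * x k * y; gaussianReal (a k) v]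
        = v / n₀ * x k ^ 2 := fun k => by
      rw [variance_const_mul]
      have := variance_fun_id_gaussianReal (μ := a k) (v := v)
      rw [this, mul_pow, div_pow, Real.sq_sqrt (by positivity)]
      ring
    simp_rw [this, ← Finset.mul_sum, hsum]
    field_simp
  refine ⟨by fun_prop, ?_⟩
  rw [heq, hG.map_eq_gaussianReal, hmean, hvar, Real.toNNReal_coe]

/-- The law of the pairs (output weight, pre-activation) of the hidden neurons. As `‖x‖² = n₀`, the
pre-activations have the same variance as the weights, so that the law depends on the input only
through the means. -/
theorem measurePreserving_neurons {n₀ n : ℕ} (hn₀ : 0 < n₀) {x : EuclideanSpace ℝ (Fin n₀)}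
    (hx : ‖x‖ = √(n₀ : ℝ)) (a : Idx n₀ n → ℝ) (v : ℝ≥0) :
    MeasurePreserving (fun (W : Idx n₀ n → ℝ) j => (W (Sum.inr j), hidden W x j))
      (Measure.pi fun i => gaussianReal (a i) v)
      (Measure.pi fun j => (gaussianReal (a (Sum.inr j)) v).prod
        (gaussianReal (hidden a x j) v)) := by
  have h1 := measurePreserving_sumPiEquivProdPi (X := fun _ : Idx n₀ n => ℝ)
    (fun i => gaussianReal (a i) v)
  have h2 := measurePreserving_curry fun p : Fin n × Fin n₀ => gaussianReal (a (Sum.inl p)) v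
  have h3 := measurePreserving_pi _ (fun j => gaussianReal (hidden a x j) v) fun j : Fin n =>
    measurePreserving_preactivation hn₀ hx (fun k => a (Sum.inl (j, k))) v
  have h4 := (h3.comp h2).prod (MeasurePreserving.id
    (Measure.pi fun j : Fin n => gaussianReal (a (Sum.inr j)) v))
  have h5 := (measurePreserving_arrowProdEquivProdArrow ℝ ℝ (Fin n)
    (fun j => gaussianReal (a (Sum.inr j)) v) (fun j => gaussianReal (hidden a x j) v)).symm
  exact h5.comp (Measure.measurePreserving_swap.comp (h4.comp h1))

/-! ### The functions `ψ` and `ξ - ψ²` -/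

theorem abs_le_of_lipschitzWith {g : ℝ → ℝ} {C : ℝ≥0} (hg : LipschitzWith C g) (u : ℝ) :
    |g u| ≤ |g 0| + C * |u| := by
  have h := hg.dist_le_mul u 0
  rw [Real.dist_eq, Real.dist_eq, sub_zero] at h
  have := abs_sub_abs_le_abs_sub (g u) (g 0)
  linarith

theorem memLp_of_lipschitzWith {g : ℝ → ℝ} {C : ℝ≥0} (hg : LipschitzWith C g) (μ : Measure ℝ)
    [IsGaussian μ] {p : ℝ≥0∞} (hp : p ≠ ∞) : MemLp g p μ := by
  have h0 : MemLp (fun _ : ℝ => |g 0|) p μ := memLp_const _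
  have h1 : MemLp (fun u : ℝ => C * |u|) p μ := by
    simpa using ((IsGaussian.memLp_id μ p hp).norm.const_mul (C : ℝ))
  refine (h0.add h1).mono hg.continuous.aestronglyMeasurable (ae_of_all _ fun u => ?_)
  rw [Real.norm_eq_abs, Real.norm_eq_abs]
  exact (abs_le_of_lipschitzWith hg u).trans (le_abs_self _)

theorem lipschitzWith_comp_add_const {g : ℝ → ℝ} {C : ℝ≥0} (hg : LipschitzWith C g) (u : ℝ) :
    LipschitzWith C fun z => g (z + u) := by
  have h := hg.comp (isometry_add_right u).lipschitz
  rw [mul_one] at h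
  exact h

theorem integral_gaussianReal_eq_shift (f : ℝ → ℝ) (u : ℝ) :
    ∫ z, f z ∂(gaussianReal u 1) = ∫ z, f (z + u) ∂(gaussianReal 0 1) := by
  have h := gaussianReal_map_add_const (μ := 0) (v := 1) u
  rw [zero_add] at h
  rw [← h]
  exact (measurableEmbedding_addRight u).integral_map f

theorem integral_sq_gaussianReal (a : ℝ) (v : ℝ≥0) :
    ∫ w, w ^ 2 ∂(gaussianReal a v) = v + a ^ 2 := by
  have h := variance_eq_sub (X := id) (μ := gaussianReal a v) IsGaussian.memLp_two_id
  rw [variance_id_gaussianReal] at h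
  simp only [Pi.pow_apply, id] at h
  rw [integral_id_gaussianReal] at h
  linarith

theorem lipschitzWith_psi {φ : ℝ → ℝ} {C : ℝ≥0} (hφ : LipschitzWith C φ) :
    LipschitzWith C (psi φ) := by
  have hint : ∀ u, Integrable (fun z => φ (z + u)) (gaussianReal 0 1) := fun u =>
    (memLp_of_lipschitzWith (lipschitzWith_comp_add_const hφ u) (gaussianReal 0 1)
      ENNReal.one_ne_top).integrable le_rfl
  refine LipschitzWith.of_dist_le_mul fun u v => ?_
  rw [Real.dist_eq, psi, psi, ← integral_sub (hint u) (hint v), ← Real.norm_eq_abs]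
  refine (norm_integral_le_of_norm_le_const (ae_of_all _ fun z => ?_)).trans_eq
    (by rw [probReal_univ, mul_one])
  have := hφ.dist_le_mul (z + u) (z + v)
  rwa [dist_add_left] at this

/-- The variance `Var[φ(ζ + u)] = ξ(u) - ψ(u)²` of a unit activation, for `ζ ∼ N(0,1)`. -/
noncomputable def gap (φ : ℝ → ℝ) (u : ℝ) : ℝ := xi φ u - psi φ u ^ 2

theorem memLp_shift {φ : ℝ → ℝ} {C : ℝ≥0} (hφ : LipschitzWith C φ) (u : ℝ) :
    MemLp (fun z => φ (z + u)) 2 (gaussianReal 0 1) :=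
  memLp_of_lipschitzWith (lipschitzWith_comp_add_const hφ u) _ ENNReal.ofNat_ne_top

theorem gap_eq_variance {φ : ℝ → ℝ} {C : ℝ≥0} (hφ : LipschitzWith C φ) (u : ℝ) :
    gap φ u = Var[fun z => φ (z + u); gaussianReal 0 1] :=
  (variance_eq_sub (memLp_shift hφ u)).symm

theorem gap_nonneg {φ : ℝ → ℝ} {C : ℝ≥0} (hφ : LipschitzWith C φ) (u : ℝ) : 0 ≤ gap φ u := by
  rw [gap_eq_variance hφ]
  exact variance_nonneg _ _

/-- Centering at the deterministic value `φ u` expresses the variance through a variable that is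
dominated by `C |ζ|`, uniformly in `u`. -/
theorem gap_eq_centered {φ : ℝ → ℝ} {C : ℝ≥0} (hφ : LipschitzWith C φ) (u : ℝ) :
    gap φ u = ∫ z, (φ (z + u) - φ u) ^ 2 ∂(gaussianReal 0 1)
      - (∫ z, φ (z + u) - φ u ∂(gaussianReal 0 1)) ^ 2 := by
  rw [gap_eq_variance hφ, ← variance_sub_const (memLp_shift hφ u).1 (φ u),
    variance_eq_sub (X := fun z => φ (z + u) - φ u) ((memLp_shift hφ u).sub (memLp_const _))]
  simp

theorem abs_centered_le {φ : ℝ → ℝ} {C : ℝ≥0} (hφ : LipschitzWith C φ) (u z : ℝ) :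
    |φ (z + u) - φ u| ≤ C * |z| := by
  have := hφ.dist_le_mul (z + u) u
  rwa [Real.dist_eq, Real.dist_eq, add_sub_cancel_right] at this

theorem gap_le {φ : ℝ → ℝ} {C : ℝ≥0} (hφ : LipschitzWith C φ) (u : ℝ) : gap φ u ≤ C ^ 2 := by
  have h2 : Integrable (fun z : ℝ => z ^ 2) (gaussianReal 0 1) :=
    IsGaussian.memLp_two_id.integrable_sq
  calc gap φ u ≤ ∫ z, (φ (z + u) - φ u) ^ 2 ∂(gaussianReal 0 1) := by
        rw [gap_eq_centered hφ]
        exact sub_le_self _ (sq_nonneg _)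
    _ ≤ ∫ z, (C : ℝ) ^ 2 * z ^ 2 ∂(gaussianReal 0 1) := by
        refine integral_mono ((memLp_shift hφ u).sub (memLp_const _)).integrable_sq
          (h2.const_mul _) fun z => ?_
        have := pow_le_pow_left₀ (abs_nonneg _) (abs_centered_le hφ u z) 2
        rwa [sq_abs, mul_pow, sq_abs] at this
    _ = C ^ 2 := by rw [integral_const_mul, integral_sq_gaussianReal]; simp

/-- The centered variables at `u` and `v` differ by at most `2 C |u - v|`, so their squares and the
squares of their means each differ by at most `4 C² |u - v|` in expectation. -/
theorem abs_gap_sub_le {φ : ℝ → ℝ} {C : ℝ≥0} (hφ : LipschitzWith C φ) (u v : ℝ) :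
    |gap φ u - gap φ v| ≤ 8 * C ^ 2 * |u - v| := by
  set γ := gaussianReal 0 1
  set X := fun z => φ (z + u) - φ u
  set Y := fun z => φ (z + v) - φ v
  have hX : MemLp X 2 γ := (memLp_shift hφ u).sub (memLp_const _)
  have hY : MemLp Y 2 γ := (memLp_shift hφ v).sub (memLp_const _)
  have hXi := hX.integrable one_le_two
  have hYi := hY.integrable one_le_two
  have h1 : Integrable (fun z : ℝ => |z|) γ := (IsGaussian.integrable_id).abs
  have h2 : Integrable (fun z : ℝ => z ^ 2) γ := IsGaussian.memLp_two_id.integrable_sq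
  have habs : ∫ z, |z| ∂γ ≤ 1 := by
    have h3 : ∫ z, |z| ∂γ ≤ ∫ z, (1 + z ^ 2) / 2 ∂γ := by
      refine integral_mono h1 (((integrable_const 1).add h2).div_const 2) fun z => ?_
      have := sq_nonneg (|z| - 1)
      have := sq_abs z
      simp only
      nlinarith
    rw [integral_div, integral_add (integrable_const 1) h2, integral_sq_gaussianReal] at h3
    simpa using h3
  have hXb : ∀ z, |X z| ≤ C * |z| := abs_centered_le hφ u
  have hYb : ∀ z, |Y z| ≤ C * |z| := abs_centered_le hφ v
  have hXY : ∀ z, |X z - Y z| ≤ 2 * C * |u - v| := fun z => by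
    have ha := hφ.dist_le_mul (z + u) (z + v)
    have hb := hφ.dist_le_mul u v
    rw [dist_add_left, Real.dist_eq, Real.dist_eq] at ha
    rw [Real.dist_eq, Real.dist_eq] at hb
    have : X z - Y z = (φ (z + u) - φ (z + v)) - (φ u - φ v) := by simp only [X, Y]; ring
    rw [this]
    exact (abs_sub _ _).trans (by linarith)
  have hint : ∀ Z : ℝ → ℝ, (∀ z, |Z z| ≤ C * |z|) → |∫ z, Z z ∂γ| ≤ C := fun Z hZ => by
    have := norm_integral_le_of_norm_le (h1.const_mul (C : ℝ)) (f := Z) (ae_of_all γ hZ)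
    rw [integral_const_mul] at this
    exact this.trans (mul_le_of_le_one_right C.2 habs)
  have hd : |∫ z, X z ∂γ - ∫ z, Y z ∂γ| ≤ 2 * C * |u - v| := by
    rw [← integral_sub hXi hYi]
    have := norm_integral_le_of_norm_le_const (μ := γ) (f := fun z => X z - Y z)
      (ae_of_all γ hXY)
    simpa using this
  have hsq : |∫ z, X z ^ 2 ∂γ - ∫ z, Y z ^ 2 ∂γ| ≤ 4 * C ^ 2 * |u - v| := by
    rw [← integral_sub hX.integrable_sq hY.integrable_sq]
    have hb : ∀ z, ‖X z ^ 2 - Y z ^ 2‖ ≤ 4 * C ^ 2 * |u - v| * |z| := fun z => by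
      have : X z ^ 2 - Y z ^ 2 = (X z - Y z) * (X z + Y z) := by ring
      rw [this, Real.norm_eq_abs, abs_mul]
      have h3 : |X z + Y z| ≤ 2 * C * |z| :=
        (abs_add_le _ _).trans (by linarith [hXb z, hYb z])
      calc _ ≤ (2 * C * |u - v|) * (2 * C * |z|) :=
            mul_le_mul (hXY z) h3 (abs_nonneg _) (by positivity)
        _ = _ := by ring
    have := norm_integral_le_of_norm_le (h1.const_mul (4 * (C : ℝ) ^ 2 * |u - v|)) (ae_of_all γ hb)
    rw [integral_const_mul] at this
    exact this.trans (mul_le_of_le_one_right (by positivity) habs)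
  have hm : |(∫ z, X z ∂γ) ^ 2 - (∫ z, Y z ∂γ) ^ 2| ≤ 4 * C ^ 2 * |u - v| := by
    rw [sq_sub_sq, abs_mul]
    have h3 : |∫ z, X z ∂γ + ∫ z, Y z ∂γ| ≤ 2 * C :=
      (abs_add_le _ _).trans (by linarith [hint X hXb, hint Y hYb])
    calc _ ≤ (2 * C) * (2 * C * |u - v|) := mul_le_mul h3 hd (abs_nonneg _) (by positivity)
      _ = _ := by ring
  rw [gap_eq_centered hφ, gap_eq_centered hφ]
  have : ∀ a b c d : ℝ, |(a - b) - (c - d)| ≤ |a - c| + |b - d| := fun a b c d => by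
    rw [show (a - b) - (c - d) = (a - c) - (b - d) by ring]; exact abs_sub _ _
  exact (this _ _ _ _).trans (by linarith)

theorem lipschitzWith_gap {φ : ℝ → ℝ} {C : ℝ≥0} (hφ : LipschitzWith C φ)
    : LipschitzWith (8 * C ^ 2) (gap φ) :=
  LipschitzWith.of_dist_le_mul fun u v => by
    rw [Real.dist_eq, Real.dist_eq]; exact_mod_cast abs_gap_sub_le hφ u v

/-! ### The output variance at finite width -/

theorem memLp_mul_prod {φ : ℝ → ℝ} {C : ℝ≥0} (hφ : LipschitzWith C φ) {a u : ℝ} {v : ℝ≥0} :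
    MemLp (fun p : ℝ × ℝ => p.1 * φ p.2) 2 ((gaussianReal a v).prod (gaussianReal u v)) := by
  have hw : Integrable (fun w : ℝ => w ^ 2) (gaussianReal a v) :=
    IsGaussian.memLp_two_id.integrable_sq
  have hf : Integrable (fun z : ℝ => φ z ^ 2) (gaussianReal u v) :=
    (memLp_of_lipschitzWith hφ _ ENNReal.ofNat_ne_top).integrable_sq
  have hm : Measurable fun p : ℝ × ℝ => p.1 * φ p.2 :=
    measurable_fst.mul (hφ.continuous.measurable.comp measurable_snd)
  rw [memLp_two_iff_integrable_sq hm.aestronglyMeasurable]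
  simp_rw [mul_pow]
  exact hw.mul_prod hf

theorem variance_mul_prod_gaussianReal {φ : ℝ → ℝ} {C : ℝ≥0} (hφ : LipschitzWith C φ) (a u : ℝ) :
    Var[fun p : ℝ × ℝ => p.1 * φ p.2; (gaussianReal a 1).prod (gaussianReal u 1)]
      = (1 + a ^ 2) * xi φ u - a ^ 2 * psi φ u ^ 2 := by
  rw [variance_eq_sub (memLp_mul_prod hφ)]
  have e1 : ((gaussianReal a 1).prod (gaussianReal u 1))[(fun p : ℝ × ℝ => p.1 * φ p.2) ^ 2]
      = (1 + a ^ 2) * xi φ u := by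
    simp only [Pi.pow_apply, mul_pow]
    rw [integral_prod_mul (fun w : ℝ => w ^ 2) (fun z => φ z ^ 2), integral_sq_gaussianReal,
      integral_gaussianReal_eq_shift, xi]
    simp
  have e2 : ((gaussianReal a 1).prod (gaussianReal u 1))[fun p : ℝ × ℝ => p.1 * φ p.2]
      = a * psi φ u := by
    rw [integral_prod_mul (fun w : ℝ => w) φ, integral_id_gaussianReal,
      integral_gaussianReal_eq_shift, psi]
  rw [e1, e2, mul_pow]

theorem outputVariance_eq {φ : ℝ → ℝ} {C : ℝ≥0} (hφ : LipschitzWith C φ)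
    {n₀ n : ℕ} (hn₀ : 0 < n₀) (ϑ : Params n₀ n)
    {x : EuclideanSpace ℝ (Fin n₀)} (hx : ‖x‖ = √(n₀ : ℝ)) :
    outputVariance φ ϑ x =
      (1 / (n : ℝ)) * ∑ j, (1 + ϑ (Sum.inr j) ^ 2) * xi φ (hidden ϑ x j)
        - (1 / (n : ℝ)) * ∑ j, ϑ (Sum.inr j) ^ 2 * psi φ (hidden ϑ x j) ^ 2 := by
  have hmp := measurePreserving_neurons (n := n) hn₀ hx ϑ 1
  have hmeas : Measurable fun q : Fin n → ℝ × ℝ => (1 / √(n : ℝ)) * ∑ j, (q j).1 * φ (q j).2 := by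
    have := hφ.continuous.measurable
    fun_prop
  have h1 : outputVariance φ ϑ x =
      Var[fun q : Fin n → ℝ × ℝ => (1 / √(n : ℝ)) * ∑ j, (q j).1 * φ (q j).2;
        Measure.pi fun j => (gaussianReal (ϑ (Sum.inr j)) 1).prod
        (gaussianReal (hidden ϑ x j) 1)] := by
    rw [← hmp.map_eq, variance_map hmeas.aemeasurable hmp.aemeasurable]
    rfl
  have h2 := variance_sum_pi (μ := fun j : Fin n => (gaussianReal (ϑ (Sum.inr j)) 1).prod
        (gaussianReal (hidden ϑ x j) 1)) (X := fun _ p => p.1 * φ p.2) fun j => memLp_mul_prod hφ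
  have h3 : (∑ j, fun q : Fin n → ℝ × ℝ => (q j).1 * φ (q j).2)
      = fun q => ∑ j, (q j).1 * φ (q j).2 := by ext q; simp
  rw [h3] at h2
  rw [h1, variance_const_mul, h2, ← mul_sub, ← Finset.sum_sub_distrib, div_pow,
    Real.sq_sqrt (by positivity), one_pow]
  simp_rw [variance_mul_prod_gaussianReal hφ]

/-! ### The lazy-training estimate -/

/-- The variance of `W φ(U)` for independent `W ∼ N(a, 1)` and `U ∼ N(u, 1)`: the contribution of
one hidden neuron to the output variance, before the normalisation by the width. -/
noncomputable def neuronVariance (φ : ℝ → ℝ) (a u : ℝ) : ℝ :=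
  (1 + a ^ 2) * xi φ u - a ^ 2 * psi φ u ^ 2

theorem outputVariance_eq_average {φ : ℝ → ℝ} {C : ℝ≥0} (hφ : LipschitzWith C φ) {n₀ n : ℕ}
    (hn₀ : 0 < n₀) (ϑ : Params n₀ n) {x : EuclideanSpace ℝ (Fin n₀)} (hx : ‖x‖ = √(n₀ : ℝ)) :
    outputVariance φ ϑ x =
      (1 / (n : ℝ)) * ∑ j, neuronVariance φ (ϑ (Sum.inr j)) (hidden ϑ x j) := by
  rw [outputVariance_eq hφ hn₀ ϑ hx, ← mul_sub, ← Finset.sum_sub_distrib]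
  rfl

/-- Writing a neuron's variance as `ψ(u)² + (1 + a²) (ξ(u) - ψ(u)²)`, whose last factor is bounded
and Lipschitz, shows that its increments are of first order, with polynomial weights at the base
point. -/
theorem exists_abs_neuronVariance_sub_le {φ : ℝ → ℝ} {C : ℝ≥0} (hφ : LipschitzWith C φ) :
    ∃ K : ℝ, 0 ≤ K ∧ ∀ a b u v : ℝ, |neuronVariance φ a u - neuronVariance φ b v| ≤
      K * ((|u - v| + |a - b|) * (1 + |v| + b ^ 2) + (|u - v| ^ 2 + |a - b| ^ 2)) := by
  set c : ℝ := (C : ℝ)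
  have hc0 : 0 ≤ c := C.2
  set P := |psi φ 0|
  have hP0 : 0 ≤ P := abs_nonneg _
  refine ⟨2 * c * (P + c) + 10 * c ^ 2, by positivity, fun a b u v => ?_⟩
  set d := |u - v|
  set e := |a - b|
  have hd0 : 0 ≤ d := abs_nonneg _
  have he0 : 0 ≤ e := abs_nonneg _
  have hv0 : 0 ≤ |v| := abs_nonneg _
  have hb0 : 0 ≤ |b| := abs_nonneg _
  have hsplit : neuronVariance φ a u - neuronVariance φ b v =
      (psi φ u - psi φ v) * (psi φ u + psi φ v) + (a - b) * (a + b) * gap φ u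
        + (1 + b ^ 2) * (gap φ u - gap φ v) := by
    unfold neuronVariance gap; ring
  have hu : |u| ≤ |v| + d := by
    have := abs_sub_abs_le_abs_sub u v
    linarith
  have hψ := lipschitzWith_psi hφ
  have t1 : |(psi φ u - psi φ v) * (psi φ u + psi φ v)| ≤
      (c * d) * (2 * P + 2 * c * |v| + c * d) := by
    rw [abs_mul]
    refine mul_le_mul (hψ.dist_le_mul u v) ((abs_add_le _ _).trans ?_) (abs_nonneg _)
      (by positivity)
    have h1 := abs_le_of_lipschitzWith hψ u
    have h2 := abs_le_of_lipschitzWith hψ v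
    have h3 := mul_le_mul_of_nonneg_left hu hc0
    linarith
  have t2 : |(a - b) * (a + b) * gap φ u| ≤ e * (e + 2 * |b|) * c ^ 2 := by
    rw [abs_mul, abs_mul, abs_of_nonneg (gap_nonneg hφ u)]
    refine mul_le_mul (mul_le_mul_of_nonneg_left ?_ he0) (gap_le hφ u) (gap_nonneg hφ u)
      (by positivity)
    have h1 : a + b = (a - b) + 2 * b := by ring
    rw [h1]
    refine (abs_add_le _ _).trans ?_
    rw [abs_mul, abs_two]
  have t3 : |(1 + b ^ 2) * (gap φ u - gap φ v)| ≤ (1 + b ^ 2) * (8 * c ^ 2 * d) := by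
    rw [abs_mul, abs_of_nonneg (by positivity : 0 ≤ 1 + b ^ 2)]
    exact mul_le_mul_of_nonneg_left (abs_gap_sub_le hφ u v) (by positivity)
  rw [hsplit]
  refine (abs_add_three _ _ _).trans ((add_le_add (add_le_add t1 t2) t3).trans ?_)
  have h2b : 2 * |b| ≤ 1 + b ^ 2 := by nlinarith [sq_nonneg (|b| - 1), sq_abs b]
  have s2 : e * (e + 2 * |b|) * c ^ 2 ≤ e * (e + (1 + b ^ 2)) * c ^ 2 := by gcongr
  refine (add_le_add (add_le_add le_rfl s2) le_rfl).trans ?_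
  -- The difference between the right-hand side of the claim and the sum of the three bounds.
  have hr : 0 ≤ 2 * c * (P + c) * (e * (1 + |v| + b ^ 2) + (d ^ 2 + e ^ 2))
      + 2 * c * P * d * (|v| + b ^ 2) + 2 * c * c * d * (1 + b ^ 2)
      + c ^ 2 * (2 * d * (1 + b ^ 2) + 10 * d * |v| + 9 * d ^ 2
        + 9 * e * (1 + b ^ 2) + 10 * e * |v| + 9 * e ^ 2) := by positivity
  linarith

theorem sum_sq_hidden_le {n₀ n : ℕ} (hn₀ : 0 < n₀) (W : Idx n₀ n → ℝ)
    {x : EuclideanSpace ℝ (Fin n₀)} (hx : ‖x‖ = √(n₀ : ℝ)) :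
    ∑ j, hidden W x j ^ 2 ≤ ∑ p : Fin n × Fin n₀, W (Sum.inl p) ^ 2 := by
  have hsum : ∑ k, x k ^ 2 = (n₀ : ℝ) := by
    rw [← EuclideanSpace.real_norm_sq_eq, hx, Real.sq_sqrt (by positivity)]
  have hn : (n₀ : ℝ) ≠ 0 := by positivity
  rw [Fintype.sum_prod_type]
  refine Finset.sum_le_sum fun j _ => ?_
  have h := Finset.sum_mul_sq_le_sq_mul_sq Finset.univ (fun k => W (Sum.inl (j, k))) x
  rw [hsum] at h
  rw [hidden, mul_pow, div_pow, Real.sq_sqrt (by positivity), one_pow, one_div,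
    inv_mul_le_iff₀ (by positivity), mul_comm]
  exact h

theorem hidden_sub {n₀ n : ℕ} (W V : Idx n₀ n → ℝ) (x : EuclideanSpace ℝ (Fin n₀)) (j : Fin n) :
    hidden W x j - hidden V x j = hidden (fun i => W i - V i) x j := by
  simp only [hidden, ← mul_sub, ← Finset.sum_sub_distrib, ← sub_mul]

/-- The lazy-training estimate. A displacement of the means of bounded Frobenius norm is spread over
`n` neurons, so that the average of the neurons' variances moves by `O(1/√n)` only, provided that
the fourth moments of the base point are under control. The weight `√n` in the inequality
`2 d s ≤ √n d² + s² / √n` balances the bounded sum of the `d²` against the sum of order `n` of the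
`s²`. -/
theorem exists_abs_outputVariance_sub_le {φ : ℝ → ℝ} {C : ℝ≥0} (hφ : LipschitzWith C φ) {n₀ : ℕ}
    (hn₀ : 0 < n₀) :
    ∃ K : ℝ, 0 ≤ K ∧ ∀ (n : ℕ) (ϑ ϑ₀ : Params n₀ n) (R B : ℝ), 0 < n → ‖ϑ - ϑ₀‖ ^ 2 ≤ R →
      ∑ i, (1 + ϑ₀ i ^ 4) ≤ B * n → ∀ x : EuclideanSpace ℝ (Fin n₀), ‖x‖ = √(n₀ : ℝ) →
      |outputVariance φ ϑ x - outputVariance φ ϑ₀ x| ≤ K * (2 * R + 3 * B) / √(n : ℝ) := by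
  obtain ⟨K, hK, hq⟩ := exists_abs_neuronVariance_sub_le hφ
  refine ⟨K, hK, fun n ϑ ϑ₀ R B hn hR hB x hx => ?_⟩
  have hn1 : (1 : ℝ) ≤ n := by exact_mod_cast hn
  set r := √(n : ℝ) with hr
  have hr1 : 1 ≤ r := Real.one_le_sqrt.2 hn1
  have hr0 : 0 < r := by linarith
  have hrr : (n : ℝ) = r * r := (Real.mul_self_sqrt (by positivity)).symm
  set d : Fin n → ℝ := fun j => |hidden ϑ x j - hidden ϑ₀ x j|
  set e : Fin n → ℝ := fun j => |ϑ (Sum.inr j) - ϑ₀ (Sum.inr j)|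
  have hdisp : ∑ j, (d j ^ 2 + e j ^ 2) ≤ R := by
    refine le_trans ?_ hR
    rw [EuclideanSpace.real_norm_sq_eq, Fintype.sum_sum_type, Finset.sum_add_distrib]
    have h := sum_sq_hidden_le hn₀ (fun i => ϑ i - ϑ₀ i) hx
    simp only [← hidden_sub] at h
    simp only [d, e, sq_abs]
    exact add_le_add h le_rfl
  have hbase : ∑ j, (1 + |hidden ϑ₀ x j| + ϑ₀ (Sum.inr j) ^ 2) ^ 2 ≤ 3 * (B * n) := by
    have h := sum_sq_hidden_le hn₀ ϑ₀ hx
    have h2 : ∑ p : Fin n × Fin n₀, ϑ₀ (Sum.inl p) ^ 2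
        ≤ ∑ p : Fin n × Fin n₀, (1 + ϑ₀ (Sum.inl p) ^ 4) :=
      Finset.sum_le_sum fun p _ => by nlinarith [sq_nonneg (ϑ₀ (Sum.inl p) ^ 2 - 1)]
    have h3 : ∑ j, (1 + |hidden ϑ₀ x j| + ϑ₀ (Sum.inr j) ^ 2) ^ 2
        ≤ ∑ j, 3 * (hidden ϑ₀ x j ^ 2 + (1 + ϑ₀ (Sum.inr j) ^ 4)) := by
      refine Finset.sum_le_sum fun j _ => ?_
      have := sq_abs (hidden ϑ₀ x j)
      nlinarith [sq_nonneg (1 - |hidden ϑ₀ x j|), sq_nonneg (1 - ϑ₀ (Sum.inr j) ^ 2),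
        sq_nonneg (|hidden ϑ₀ x j| - ϑ₀ (Sum.inr j) ^ 2)]
    rw [← Finset.mul_sum, Finset.sum_add_distrib] at h3
    rw [Fintype.sum_sum_type] at hB
    linarith
  rw [outputVariance_eq_average hφ hn₀ ϑ hx, outputVariance_eq_average hφ hn₀ ϑ₀ hx, ← mul_sub,
    ← Finset.sum_sub_distrib, abs_mul, abs_of_nonneg (by positivity)]
  have hterm : ∀ j, |neuronVariance φ (ϑ (Sum.inr j)) (hidden ϑ x j)
      - neuronVariance φ (ϑ₀ (Sum.inr j)) (hidden ϑ₀ x j)| ≤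
      K * (2 * r * (d j ^ 2 + e j ^ 2)
        + (1 + |hidden ϑ₀ x j| + ϑ₀ (Sum.inr j) ^ 2) ^ 2 / r) := fun j => by
    refine (hq _ _ _ _).trans (mul_le_mul_of_nonneg_left ?_ hK)
    change (d j + e j) * (1 + |hidden ϑ₀ x j| + ϑ₀ (Sum.inr j) ^ 2) + (d j ^ 2 + e j ^ 2) ≤ _
    generalize 1 + |hidden ϑ₀ x j| + ϑ₀ (Sum.inr j) ^ 2 = s
    generalize d j = y
    generalize e j = z
    have h1 : s ^ 2 / r = r * (s / r) ^ 2 := by field_simp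
    have h2 : (y + z) * s = r * ((y + z) * (s / r)) := by field_simp
    rw [h1, h2]
    generalize s / r = q
    have h3 : (y + z) * q ≤ y ^ 2 + z ^ 2 + q ^ 2 := by
      nlinarith [sq_nonneg (y - z), sq_nonneg (y + z - q), sq_nonneg (y + z - 2 * q)]
    have h4 := mul_le_mul_of_nonneg_left h3 hr0.le
    have h5 : y ^ 2 + z ^ 2 ≤ r * (y ^ 2 + z ^ 2) := le_mul_of_one_le_left (by positivity) hr1
    linarith
  have hsum := (Finset.abs_sum_le_sum_abs _ Finset.univ).trans
    (Finset.sum_le_sum fun j (_ : j ∈ Finset.univ) => hterm j)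
  rw [← Finset.mul_sum, Finset.sum_add_distrib, ← Finset.mul_sum, ← Finset.sum_div] at hsum
  have hfin : 2 * r * ∑ j, (d j ^ 2 + e j ^ 2)
      + (∑ j, (1 + |hidden ϑ₀ x j| + ϑ₀ (Sum.inr j) ^ 2) ^ 2) / r ≤ r * (2 * R + 3 * B) := by
    have h1 : (∑ j, (1 + |hidden ϑ₀ x j| + ϑ₀ (Sum.inr j) ^ 2) ^ 2) / r ≤ 3 * B * r := by
      rw [div_le_iff₀ hr0]
      rw [hrr] at hbase
      linarith
    have h2 := mul_le_mul_of_nonneg_left hdisp (by positivity : 0 ≤ 2 * r)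
    linarith
  calc _ ≤ 1 / (n : ℝ) * (K * (r * (2 * R + 3 * B))) := by gcongr; exact hsum.trans (by gcongr)
    _ = K * (2 * R + 3 * B) / r := by rw [hrr]; field_simp

/-! ### Gradient flow stays close to its initial point -/

/-- Along a gradient flow the objective decreases. As the loss is non-negative, the whole
trajectory stays in a ball around the initial point, whose radius is controlled by the initial
loss. -/
theorem norm_sub_sq_le_of_isGradientFlow {n₀ n m : ℕ} (hm : 0 < m) {η : ℝ} (hη : 0 < η)
    {L : Params n₀ n → ℝ} (hL : ∀ ϑ, 0 ≤ L ϑ) {θ : ℝ → Params n₀ n}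
    (hθ : IsGradientFlow (pacObjective L η m (θ 0)) θ) {t : ℝ} (ht : 0 ≤ t) :
    ‖θ t - θ 0‖ ^ 2 ≤ 2 * η * √(8 * (m : ℝ)) * L (θ 0) := by
  set F := pacObjective L η m (θ 0) with hF
  have hder : ∀ s, 0 ≤ s → ∃ F' : ℝ, F' ≤ 0 ∧
      HasDerivWithinAt (fun s => F (θ s)) F' (Set.Ici 0) s := fun s hs => by
    obtain ⟨g, hg, hd⟩ := hθ s hs
    have h := hg.hasFDerivAt.comp_hasDerivWithinAt s hd
    refine ⟨_, ?_, h⟩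
    simp
  have hanti : AntitoneOn (fun s => F (θ s)) (Set.Ici 0) := by
    refine antitoneOn_of_deriv_nonpos (convex_Ici 0) ?_ ?_ ?_
    · intro s hs
      obtain ⟨F', -, h⟩ := hder s hs
      exact h.continuousWithinAt
    · intro s hs
      rw [interior_Ici] at hs
      obtain ⟨F', -, h⟩ := hder s (le_of_lt hs)
      exact (h.hasDerivAt (Ici_mem_nhds hs)).differentiableAt.differentiableWithinAt
    · intro s hs
      rw [interior_Ici] at hs
      obtain ⟨F', h0, h⟩ := hder s (le_of_lt hs)
      rw [(h.hasDerivAt (Ici_mem_nhds hs)).deriv]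
      exact h0
  have h := hanti (Set.mem_Ici.2 le_rfl) (Set.mem_Ici.2 ht) ht
  simp only [hF, pacObjective, sub_self, norm_zero, ne_eq, OfNat.ofNat_ne_zero, not_false_eq_true,
    zero_pow, mul_zero, add_zero] at h
  have hc : 0 < 2 * η * √(8 * (m : ℝ)) := by positivity
  have h1 := hL (θ t)
  have h2 : 1 / (2 * η * √(8 * (m : ℝ))) * ‖θ t - θ 0‖ ^ 2 ≤ L (θ 0) := by
    linarith
  rwa [one_div, inv_mul_le_iff₀ hc] at h2

/-! ### Exponential moments of the output at random weights -/

theorem lintegral_exp_mul_gaussianReal (v : ℝ≥0) (s : ℝ) :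
    ∫⁻ w, ENNReal.ofReal (Real.exp (s * w)) ∂(gaussianReal 0 v)
      = ENNReal.ofReal (Real.exp (v * s ^ 2 / 2)) := by
  rw [← ofReal_integral_eq_lintegral_ofReal (integrable_exp_mul_gaussianReal s)
    (ae_of_all _ fun _ => (Real.exp_pos _).le)]
  have h := congrFun (mgf_id_gaussianReal (μ := 0) (v := v)) s
  simp only [mgf, id] at h
  rw [h, zero_mul, zero_add]

/-- The `n`-th power of `𝔼[exp(X / n)]` decreases with `n`, being an `L^p` norm with `p = 1 / n`. -/
theorem lintegral_exp_div_pow_le {α : Type*} [MeasurableSpace α] (P : Measure α)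
    [IsProbabilityMeasure P] {f : α → ℝ} (hf : Measurable f) {N n : ℕ} (hN : 0 < N) (hn : N ≤ n) :
    (∫⁻ a, ENNReal.ofReal (Real.exp (f a / n)) ∂P) ^ n
      ≤ (∫⁻ a, ENNReal.ofReal (Real.exp (f a / N)) ∂P) ^ N := by
  have key : ∀ k : ℕ, 0 < k → eLpNorm' (fun a => Real.exp (f a)) (1 / (k : ℝ)) P
      = (∫⁻ a, ENNReal.ofReal (Real.exp (f a / k)) ∂P) ^ k := fun k hk => by
    rw [eLpNorm', one_div_one_div, ENNReal.rpow_natCast]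
    congr 2 with a
    rw [← ofReal_norm, Real.norm_eq_abs, Real.abs_exp,
      ENNReal.ofReal_rpow_of_pos (Real.exp_pos _), ← Real.exp_mul, mul_one_div]
  rw [← key n (hN.trans_le hn), ← key N hN]
  refine eLpNorm'_le_eLpNorm'_of_exponent_le (one_div_pos.2 (by exact_mod_cast hN.trans_le hn))
    (one_div_le_one_div_of_le (by exact_mod_cast hN) (by exact_mod_cast hn)) P ?_
  exact (Real.measurable_exp.comp hf).aestronglyMeasurable

theorem exists_forall_lintegral_exp_pow_le (v : ℝ≥0) {c : ℝ} (hc : 0 ≤ c) :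
    ∃ A : ℝ≥0∞, A ≠ ∞ ∧ ∃ N : ℕ, 0 < N ∧ ∀ n, N ≤ n →
      (∫⁻ u, ENNReal.ofReal (Real.exp (c * (1 + u ^ 2) / n)) ∂(gaussianReal 0 v)) ^ n ≤ A := by
  obtain ⟨δ, hδ, hint⟩ := IsGaussian.exists_integrable_exp_sq (gaussianReal 0 v)
  -- From this width on, Fernique's exponent `δ` dominates `c / n`.
  obtain ⟨N, hN⟩ := exists_nat_gt (c / δ)
  have hN0 : 0 < N := by
    have : (0 : ℝ) < N := (by positivity : 0 ≤ c / δ).trans_lt hN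
    exact_mod_cast this
  have hNr : (0 : ℝ) < N := by exact_mod_cast hN0
  have hcN : c / N ≤ δ := by
    rw [div_le_iff₀ hNr, mul_comm]; exact ((div_lt_iff₀ hδ).1 hN).le
  refine ⟨_, ENNReal.pow_ne_top ?_, N, hN0, fun n hn =>
    lintegral_exp_div_pow_le _ (by fun_prop) hN0 hn⟩
  refine ((lintegral_mono fun u => ENNReal.ofReal_le_ofReal ?_).trans_lt
    (hint.const_mul (Real.exp (c / N))).lintegral_lt_top).ne
  rw [← Real.exp_add, Real.exp_le_exp, Real.norm_eq_abs, sq_abs, mul_one_add, add_div,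
    mul_div_right_comm]
  gcongr

theorem lintegral_exp_sum_pi {E : Type*} [MeasurableSpace E] (P : Measure E)
    [IsProbabilityMeasure P] {f : E → ℝ} (hf : Measurable f) (n : ℕ) :
    ∫⁻ q : Fin n → E, ENNReal.ofReal (Real.exp (∑ j, f (q j))) ∂(Measure.pi fun _ => P)
      = (∫⁻ p, ENNReal.ofReal (Real.exp (f p)) ∂P) ^ n := by
  have hm : Measurable fun p => ENNReal.ofReal (Real.exp (f p)) := by fun_prop
  have hind := iIndepFun_pi (ι := Fin n) (μ := fun _ => P)
    (X := fun _ p => ENNReal.ofReal (Real.exp (f p))) fun _ => hm.aemeasurable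
  have h := lintegral_prod_eq_prod_lintegral_of_indepFun Finset.univ _ hind
    (fun j => hm.comp (measurable_pi_apply j))
  simp only [Real.exp_sum]
  simp_rw [ENNReal.ofReal_prod_of_nonneg (s := Finset.univ) fun j _ => (Real.exp_pos _).le]
  rw [h]
  have : ∀ j : Fin n, ∫⁻ q : Fin n → E, ENNReal.ofReal (Real.exp (f (q j))) ∂(Measure.pi fun _ => P)
      = ∫⁻ p, ENNReal.ofReal (Real.exp (f p)) ∂P := fun j =>
    (measurePreserving_eval (fun _ : Fin n => P) j).lintegral_comp hm
  simp only [this, Finset.prod_const, Finset.card_univ, Fintype.card_fin]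

theorem measurable_output {n₀ n : ℕ} {g : ℝ → ℝ} (hg : Measurable g)
    (x : EuclideanSpace ℝ (Fin n₀)) : Measurable fun W : Idx n₀ n → ℝ => output g W x := by
  unfold output
  exact measurable_const.mul (Finset.measurable_sum _ fun j _ =>
    (measurable_pi_apply _).mul (hg.comp (measurable_hidden x j)))

/-- Given the first layer, the output of a network with centered Gaussian weights is a Gaussian
variable, whose variance is an average over the neurons: integrating the second layer first leaves
the `n`-th power of `𝔼[exp(v κ² g(U)² / (2 n))]`, and `g(U)²` grows at most quadratically. -/
theorem exists_lintegral_exp_output_le {g : ℝ → ℝ} {C : ℝ≥0} (hg : LipschitzWith C g) (v : ℝ≥0)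
    (κ : ℝ) {n₀ : ℕ} (hn₀ : 0 < n₀) :
    ∃ A : ℝ≥0∞, A ≠ ∞ ∧ ∀ᶠ n : ℕ in atTop, ∀ x : EuclideanSpace ℝ (Fin n₀), ‖x‖ = √(n₀ : ℝ) →
      ∫⁻ W : Idx n₀ n → ℝ, ENNReal.ofReal (Real.exp (κ * output g W x))
        ∂(Measure.pi fun _ => gaussianReal 0 v) ≤ A := by
  -- A bound of `v κ² g(u)² / 2` by `c (1 + u²)`, from `|g u| ≤ |g 0| + C |u|`.
  set c : ℝ := v * κ ^ 2 / 2 * (2 * (|g 0| ^ 2 + C ^ 2)) with hc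
  obtain ⟨A, hA, N, hN, hAN⟩ := exists_forall_lintegral_exp_pow_le v (by positivity : 0 ≤ c)
  refine ⟨A, hA, eventually_atTop.2 ⟨N, fun n hn x hx => ?_⟩⟩
  have hn0 : (0 : ℝ) < n := by exact_mod_cast hN.trans_le hn
  have hgm := hg.continuous.measurable
  have hmp := measurePreserving_neurons (n := n) hn₀ hx 0 v
  have hh : ∀ j : Fin n, hidden (0 : Idx n₀ n → ℝ) x j = 0 := fun j => by simp [hidden]
  simp only [Pi.zero_apply, hh] at hmp
  set f : ℝ × ℝ → ℝ := fun p => κ / √(n : ℝ) * g p.2 * p.1 with hf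
  have hfm : Measurable f := by fun_prop
  have h1 : ∫⁻ W : Idx n₀ n → ℝ, ENNReal.ofReal (Real.exp (κ * output g W x))
        ∂(Measure.pi fun _ => gaussianReal 0 v)
      = ∫⁻ q : Fin n → ℝ × ℝ, ENNReal.ofReal (Real.exp (∑ j, f (q j)))
        ∂(Measure.pi fun _ => (gaussianReal 0 v).prod (gaussianReal 0 v)) := by
    rw [← hmp.lintegral_comp (by fun_prop)]
    refine lintegral_congr fun W => ?_
    congr 2
    simp only [hf, output, Finset.mul_sum]
    exact Finset.sum_congr rfl fun j _ => by ring
  rw [h1, lintegral_exp_sum_pi _ hfm]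
  refine le_trans (pow_le_pow_left' ?_ n) (hAN n hn)
  rw [lintegral_prod_symm _ (by fun_prop)]
  refine lintegral_mono fun u => ?_
  simp only [hf]
  rw [lintegral_exp_mul_gaussianReal]
  refine ENNReal.ofReal_le_ofReal (Real.exp_le_exp.2 ?_)
  have hgu : g u ^ 2 ≤ 2 * (|g 0| ^ 2 + C ^ 2) * (1 + u ^ 2) := by
    have h2 := pow_le_pow_left₀ (abs_nonneg _) (abs_le_of_lipschitzWith hg u) 2
    rw [sq_abs] at h2
    have h3 := sq_abs u
    have h4 : 0 ≤ |g 0| ^ 2 * u ^ 2 := by positivity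
    have h5 : 0 ≤ (C : ℝ) ^ 2 := by positivity
    nlinarith [sq_nonneg (|g 0| - C * |u|)]
  calc (v : ℝ) * (κ / √(n : ℝ) * g u) ^ 2 / 2 = v * κ ^ 2 / 2 * g u ^ 2 / n := by
        rw [mul_pow, div_pow, Real.sq_sqrt hn0.le]; ring
    _ ≤ v * κ ^ 2 / 2 * (2 * (|g 0| ^ 2 + C ^ 2) * (1 + u ^ 2)) / n := by gcongr
    _ = c * (1 + u ^ 2) / n := by rw [hc]; ring

theorem exists_lintegral_exp_abs_output_le {g : ℝ → ℝ} {C : ℝ≥0} (hg : LipschitzWith C g) (v : ℝ≥0)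
    (κ : ℝ) {n₀ : ℕ} (hn₀ : 0 < n₀) :
    ∃ A : ℝ≥0∞, A ≠ ∞ ∧ ∀ᶠ n : ℕ in atTop, ∀ x : EuclideanSpace ℝ (Fin n₀), ‖x‖ = √(n₀ : ℝ) →
      ∫⁻ W : Idx n₀ n → ℝ, ENNReal.ofReal (Real.exp (κ * |output g W x|))
        ∂(Measure.pi fun _ => gaussianReal 0 v) ≤ A := by
  obtain ⟨A₁, hA₁, h₁⟩ := exists_lintegral_exp_output_le hg v κ hn₀
  obtain ⟨A₂, hA₂, h₂⟩ := exists_lintegral_exp_output_le hg v (-κ) hn₀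
  refine ⟨A₁ + A₂, ENNReal.add_ne_top.2 ⟨hA₁, hA₂⟩, ?_⟩
  filter_upwards [h₁, h₂] with n hn₁ hn₂ x hx
  have hm := measurable_output (n := n) hg.continuous.measurable x
  refine le_trans ?_ (add_le_add (hn₁ x hx) (hn₂ x hx))
  rw [← lintegral_add_left (by fun_prop)]
  refine lintegral_mono fun W => ?_
  rcases abs_cases (output g W x) with ⟨h, -⟩ | ⟨h, -⟩ <;> rw [h]
  · exact le_self_add
  · rw [mul_neg, ← neg_mul]
    exact le_add_self

/-! ### Tightness of the initial loss -/

theorem measurePreserving_add_weightLaw {n₀ n : ℕ} (ϑ : Params n₀ n) :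
    MeasurePreserving (fun (V : Idx n₀ n → ℝ) i => ϑ i + V i)
      (Measure.pi fun _ => gaussianReal 0 1) (weightLaw ϑ) := by
  refine measurePreserving_pi _ _ fun i => ⟨by fun_prop, ?_⟩
  rw [gaussianReal_map_const_add, zero_add]

/-- The sum of two independent standard Gaussian vectors has independent entries of variance `2`.
-/
theorem measurePreserving_add_pi_gaussianReal (ι : Type*) [Fintype ι] :
    MeasurePreserving (fun (p : (ι → ℝ) × (ι → ℝ)) i => p.1 i + p.2 i)
      ((Measure.pi fun _ => gaussianReal 0 1).prod (Measure.pi fun _ => gaussianReal 0 1))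
      (Measure.pi fun _ => gaussianReal 0 2) := by
  have h1 := (measurePreserving_arrowProdEquivProdArrow ℝ ℝ ι
    (fun _ => gaussianReal 0 1) (fun _ => gaussianReal 0 1)).symm
  have h2 : MeasurePreserving (fun p : ℝ × ℝ => p.1 + p.2)
      ((gaussianReal 0 1).prod (gaussianReal 0 1)) (gaussianReal 0 2) := by
    refine ⟨by fun_prop, ?_⟩
    have h := gaussianReal_conv_gaussianReal (m₁ := 0) (m₂ := 0) (v₁ := 1) (v₂ := 1)
    rw [Measure.conv, add_zero, one_add_one_eq_two] at h
    exact h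
  exact (measurePreserving_pi (fun _ : ι => (gaussianReal 0 1).prod (gaussianReal 0 1))
    (fun _ => gaussianReal 0 2) fun _ => h2).comp h1

/-- `L` is a random loss of bounded expectation at a standard Gaussian initialisation: it has a
measurable upper bound whose integral is at most `A`. The bound `G` avoids having to discuss the
measurability of `L`. -/
def HasInitialMeanLE {n₀ n : ℕ} (L : Params n₀ n → ℝ) (A : ℝ≥0∞) : Prop :=
  ∃ G : (Idx n₀ n → ℝ) → ℝ≥0∞, Measurable G ∧ (∀ ϑ : Params n₀ n, ENNReal.ofReal (L ϑ) ≤ G ϑ) ∧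
    ∫⁻ w, G w ∂(Measure.pi fun _ => gaussianReal 0 1) ≤ A

section Loss

variable {φ : ℝ → ℝ} {C : ℝ≥0} {ℓ : ℝ → ℤˣ → ℝ} {K κ : ℝ} {n₀ m : ℕ}
  {X : Fin m → EuclideanSpace ℝ (Fin n₀)}

theorem enorm_loss_le (hℓ_nonneg : ∀ u y, 0 ≤ ℓ u y)
    (hℓ : ∀ u y, ℓ u y ≤ K * Real.exp (κ * |u|)) (u : ℝ) (y : ℤˣ) :
    ‖ℓ u y‖ₑ ≤ ENNReal.ofReal K * ENNReal.ofReal (Real.exp (|κ| * |u|)) := by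
  have hK : 0 ≤ K := nonneg_of_mul_nonneg_left ((hℓ_nonneg 0 1).trans (hℓ 0 1)) (Real.exp_pos _)
  rw [Real.enorm_of_nonneg (hℓ_nonneg u y), ← ENNReal.ofReal_mul hK]
  refine ENNReal.ofReal_le_ofReal ((hℓ u y).trans ?_)
  gcongr
  exact le_abs_self κ

theorem enorm_average_le (f : Fin m → ℝ) :
    ‖(1 / (m : ℝ)) * ∑ i, f i‖ₑ ≤ ∑ i, ‖f i‖ₑ := by
  rw [enorm_mul]
  refine (mul_le_mul' ?_ (enorm_sum_le _ _)).trans_eq (one_mul _)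
  rw [Real.enorm_of_nonneg (by positivity), ← ENNReal.ofReal_one]
  refine ENNReal.ofReal_le_ofReal ?_
  rw [one_div]
  exact Nat.cast_inv_le_one m

/-- The random weights at initialisation, seen from the joint randomness of the means and of the
fluctuations, are centered Gaussian variables of variance `2`. -/
theorem exists_hasInitialMeanLE_expectedLoss (hφ : LipschitzWith C φ)
    (hℓ_nonneg : ∀ u y, 0 ≤ ℓ u y) (hℓ : ∀ u y, ℓ u y ≤ K * Real.exp (κ * |u|)) (hn₀ : 0 < n₀)
    (hX : ∀ i, ‖X i‖ = √(n₀ : ℝ)) (Y : Fin m → ℤˣ) :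
    ∃ A : ℝ≥0∞, A ≠ ∞ ∧
      ∀ᶠ n : ℕ in atTop, HasInitialMeanLE (n := n) (expectedLoss φ ℓ X Y) A := by
  obtain ⟨A, hA, hAn⟩ := exists_lintegral_exp_abs_output_le hφ 2 |κ| hn₀
  refine ⟨∑ _i : Fin m, ENNReal.ofReal K * A, ?_, ?_⟩
  · exact ENNReal.sum_ne_top.2 fun _ _ => ENNReal.mul_ne_top ENNReal.ofReal_ne_top hA
  filter_upwards [hAn] with n hn
  set f : (Idx n₀ n → ℝ) → ℝ≥0∞ := fun W =>
    ∑ i, ENNReal.ofReal K * ENNReal.ofReal (Real.exp (|κ| * |output φ W (X i)|)) with hf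
  have hm := fun i => measurable_output (n := n) hφ.continuous.measurable (X i)
  have hfm : Measurable f := by fun_prop
  have hfadd : Measurable fun p : (Idx n₀ n → ℝ) × (Idx n₀ n → ℝ) => f fun i => p.1 i + p.2 i :=
    hfm.comp (by fun_prop)
  refine ⟨fun w => ∫⁻ V, f (fun i => w i + V i) ∂(Measure.pi fun _ => gaussianReal 0 1),
    hfadd.lintegral_prod_right', fun ϑ => ?_, ?_⟩
  · beta_reduce
    rw [(measurePreserving_add_weightLaw ϑ).lintegral_comp hfm]
    -- This inequality holds without integrability, the junk value `0` of the integral included.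
    refine (Real.ofReal_le_enorm _).trans ((enorm_integral_le_lintegral_enorm _).trans ?_)
    refine lintegral_mono fun W => (enorm_average_le _).trans ?_
    exact Finset.sum_le_sum fun i _ => enorm_loss_le hℓ_nonneg hℓ _ _
  · rw [lintegral_lintegral hfadd.aemeasurable,
      (measurePreserving_add_pi_gaussianReal (Idx n₀ n)).lintegral_comp hfm, hf,
      lintegral_finsetSum _ fun i _ => by fun_prop]
    refine Finset.sum_le_sum fun i _ => ?_
    rw [lintegral_const_mul _ (by fun_prop)]
    gcongr
    exact hn (X i) (hX i)

theorem lintegral_exp_mul_abs_lt_top (s : ℝ) :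
    ∫⁻ z, ENNReal.ofReal (Real.exp (s * |z|)) ∂(gaussianReal 0 1) < ∞ := by
  refine ((integrable_exp_mul_gaussianReal s).add
    (integrable_exp_mul_gaussianReal (-s))).lintegral_lt_top.trans_le' (lintegral_mono fun z => ?_)
  refine ENNReal.ofReal_le_ofReal ?_
  have h1 := Real.exp_pos (s * z)
  have h2 := Real.exp_pos (-s * z)
  rcases abs_cases z with ⟨h, -⟩ | ⟨h, -⟩ <;> rw [h, Pi.add_apply]
  · linarith
  · rw [mul_neg, ← neg_mul]
    linarith

/-- The noise `σ ζ` only contributes a constant factor to the exponential moments, and `M²` is the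
output of a network with activation `ψ` and standard Gaussian weights. -/
theorem exists_hasInitialMeanLE_limitLoss (hφ : LipschitzWith C φ)
    (hℓ_nonneg : ∀ u y, 0 ≤ ℓ u y) (hℓ : ∀ u y, ℓ u y ≤ K * Real.exp (κ * |u|)) (hn₀ : 0 < n₀)
    (hX : ∀ i, ‖X i‖ = √(n₀ : ℝ)) (Y : Fin m → ℤˣ) :
    ∃ A : ℝ≥0∞, A ≠ ∞ ∧
      ∀ᶠ n : ℕ in atTop, HasInitialMeanLE (n := n) (limitLoss φ ℓ X Y) A := by
  have hψ := lipschitzWith_psi hφ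
  obtain ⟨A, hA, hAn⟩ := exists_lintegral_exp_abs_output_le hψ 1 |κ| hn₀
  set σ := √(sigmaSq φ) with hσ
  set D := ∫⁻ z, ENNReal.ofReal (Real.exp (|κ| * σ * |z|)) ∂(gaussianReal 0 1) with hD
  have hDtop : D ≠ ∞ := (lintegral_exp_mul_abs_lt_top _).ne
  refine ⟨∑ _i : Fin m, ENNReal.ofReal K * D * A, ?_, ?_⟩
  · exact ENNReal.sum_ne_top.2 fun _ _ =>
      ENNReal.mul_ne_top (ENNReal.mul_ne_top ENNReal.ofReal_ne_top hDtop) hA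
  filter_upwards [hAn] with n hn
  have hm := fun i => measurable_output (n := n) hψ.continuous.measurable (X i)
  refine ⟨fun w => ∑ i, ENNReal.ofReal K * D *
    ENNReal.ofReal (Real.exp (|κ| * |output (psi φ) w (X i)|)), by fun_prop, fun ϑ => ?_, ?_⟩
  · refine (Real.ofReal_le_enorm _).trans ((enorm_average_le _).trans ?_)
    refine Finset.sum_le_sum fun i _ => (enorm_integral_le_lintegral_enorm _).trans ?_
    set M := output (psi φ) ϑ (X i)
    rw [mul_right_comm, hD, ← lintegral_const_mul _ (by fun_prop)]
    refine lintegral_mono fun z => (enorm_loss_le hℓ_nonneg hℓ _ _).trans ?_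
    rw [mul_assoc, ← ENNReal.ofReal_mul (Real.exp_pos _).le, ← Real.exp_add]
    gcongr
    have h : |σ * z + M| ≤ σ * |z| + |M| := (abs_add_le _ _).trans_eq (by
      rw [abs_mul, abs_of_nonneg (Real.sqrt_nonneg _ : 0 ≤ σ)])
    have := mul_le_mul_of_nonneg_left h (abs_nonneg κ)
    linarith
  · rw [lintegral_finsetSum _ fun i _ => by fun_prop]
    refine Finset.sum_le_sum fun i _ => ?_
    rw [lintegral_const_mul _ (by fun_prop)]
    gcongr
    exact hn (X i) (hX i)

theorem expectedLoss_nonneg (hℓ_nonneg : ∀ u y, 0 ≤ ℓ u y) (Y : Fin m → ℤˣ) {n : ℕ}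
    (ϑ : Params n₀ n) : 0 ≤ expectedLoss φ ℓ X Y ϑ :=
  integral_nonneg fun _ =>
    mul_nonneg (by positivity) (Finset.sum_nonneg fun _ _ => hℓ_nonneg _ _)

theorem limitLoss_nonneg (hℓ_nonneg : ∀ u y, 0 ≤ ℓ u y) (Y : Fin m → ℤˣ) {n : ℕ}
    (ϑ : Params n₀ n) : 0 ≤ limitLoss φ ℓ X Y ϑ :=
  mul_nonneg (by positivity)
    (Finset.sum_nonneg fun _ _ => integral_nonneg fun _ => hℓ_nonneg _ _)

end Loss

/-- Markov's inequality, as a uniform tightness statement: the threshold depends on the bound of the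
expectations only. -/
theorem exists_forall_measure_le_of_lintegral_le {A ε : ℝ≥0∞} (hA : A ≠ ∞) (hε : 0 < ε) :
    ∃ B : ℝ, 0 < B ∧ ∀ {Ω : Type*} [MeasurableSpace Ω] (μ : Measure Ω) (G : Ω → ℝ≥0∞),
      AEMeasurable G μ → ∫⁻ ω, G ω ∂μ ≤ A → μ {ω | ENNReal.ofReal B ≤ G ω} ≤ ε := by
  have hB : 0 < (A / ε).toReal + 1 := by positivity
  refine ⟨(A / ε).toReal + 1, hB, fun μ G hG hGA => ?_⟩
  have hB' : ENNReal.ofReal ((A / ε).toReal + 1) ≠ 0 := (ENNReal.ofReal_pos.2 hB).ne'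
  refine (meas_ge_le_lintegral_div hG hB' ENNReal.ofReal_ne_top).trans ?_
  refine ENNReal.div_le_of_le_mul (hGA.trans ?_)
  rw [mul_comm]
  refine (ENNReal.div_le_iff_le_mul (Or.inl hε.ne') (Or.inr hB')).1 ?_
  rw [ENNReal.le_ofReal_iff_toReal_le (ENNReal.div_ne_top hA hε.ne') hB.le]
  linarith

theorem exists_forall_measure_loss_le {A ε : ℝ≥0∞} (hA : A ≠ ∞) (hε : 0 < ε) :
    ∃ B : ℝ, ∀ {Ω : Type*} [MeasurableSpace Ω] (μ : Measure Ω) {n₀ n : ℕ} (ϑ₀ : Ω → Params n₀ n),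
      HasLaw (fun ω i => ϑ₀ ω i) (Measure.pi fun _ => gaussianReal 0 1) μ →
      ∀ L : Params n₀ n → ℝ, HasInitialMeanLE L A → μ {ω | B < L (ϑ₀ ω)} ≤ ε := by
  obtain ⟨B, -, h⟩ := exists_forall_measure_le_of_lintegral_le hA hε
  refine ⟨B, fun μ n₀ n ϑ₀ hlaw L ⟨G, hG, hLG, hGA⟩ => ?_⟩
  refine (measure_mono fun ω hω => ?_).trans (h μ (fun ω => G (ϑ₀ ω))
    (hG.comp_aemeasurable hlaw.aemeasurable) ?_)
  · exact (ENNReal.ofReal_le_ofReal (le_of_lt hω)).trans (hLG _)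
  · rwa [hlaw.lintegral_comp hG.aemeasurable]

/-- The fourth moments of the initial parameters add up to `O(n)` with high probability. -/
theorem exists_forall_measure_sum_pow_four_le (n₀ : ℕ) {ε : ℝ≥0∞} (hε : 0 < ε) :
    ∃ B : ℝ, ∀ {Ω : Type*} [MeasurableSpace Ω] (μ : Measure Ω) {n : ℕ} (ϑ₀ : Ω → Params n₀ n),
      0 < n → (∀ i, HasLaw (fun ω => ϑ₀ ω i) (gaussianReal 0 1) μ) →
      μ {ω | B * n < ∑ i, (1 + ϑ₀ ω i ^ 4)} ≤ ε := by
  set D := ∫⁻ z : ℝ, ENNReal.ofReal (1 + z ^ 4) ∂(gaussianReal 0 1)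
  have hDtop : D ≠ ∞ := by
    have h4 : Integrable (fun z : ℝ => z ^ 4) (gaussianReal 0 1) := by
      have := (IsGaussian.memLp_id (gaussianReal 0 1) 4 (by norm_num)).integrable_norm_pow (p := 4)
        (by norm_num)
      refine this.congr (ae_of_all _ fun z => ?_)
      simp [Even.pow_abs (by decide : Even 4)]
    exact ((integrable_const 1).add h4).lintegral_lt_top.ne
  have hA : ((n₀ + 1 : ℕ) : ℝ≥0∞) * D ≠ ∞ := ENNReal.mul_ne_top (ENNReal.natCast_ne_top _) hDtop
  obtain ⟨B, hB0, h⟩ := exists_forall_measure_le_of_lintegral_le hA hε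
  refine ⟨B, fun μ n ϑ₀ hn hlaw => ?_⟩
  have hn0 : (0 : ℝ) < n := by exact_mod_cast hn
  have hm : ∀ i, AEMeasurable (fun ω => ϑ₀ ω i) μ := fun i => (hlaw i).aemeasurable
  refine (measure_mono fun ω hω => ?_).trans (h μ
    (fun ω => (n : ℝ≥0∞)⁻¹ * ∑ i, ENNReal.ofReal (1 + ϑ₀ ω i ^ 4)) (by fun_prop) ?_)
  · simp only [Set.mem_ofPred_eq] at hω ⊢
    rw [← ENNReal.ofReal_sum_of_nonneg fun i _ => by positivity, mul_comm, ← div_eq_mul_inv,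
      ENNReal.le_div_iff_mul_le (Or.inl (by exact_mod_cast hn.ne')) (Or.inl (by simp)),
      ← ENNReal.ofReal_natCast, ← ENNReal.ofReal_mul hB0.le]
    exact ENNReal.ofReal_le_ofReal hω.le
  · rw [lintegral_const_mul'' _ (by fun_prop), lintegral_finsetSum' _ fun i _ => by fun_prop]
    have : ∀ i, ∫⁻ ω, ENNReal.ofReal (1 + ϑ₀ ω i ^ 4) ∂μ = D := fun i =>
      (hlaw i).lintegral_comp (f := fun z => ENNReal.ofReal (1 + z ^ 4)) (by fun_prop)
    simp only [this, Finset.sum_const, Finset.card_univ, nsmul_eq_mul]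
    have hcard : Fintype.card (Idx n₀ n) = n * (n₀ + 1) := by simp; ring
    rw [hcard, Nat.cast_mul, mul_assoc, ← mul_assoc, ENNReal.inv_mul_cancel, one_mul]
    · exact_mod_cast hn.ne'
    · simp

/-! ### Convergence at initialisation and variation during training -/

theorem memLp_sq_of_lipschitzWith {g : ℝ → ℝ} {C : ℝ≥0} (hg : LipschitzWith C g) (μ : Measure ℝ)
    [IsGaussian μ] : MemLp (fun u => g u ^ 2) 2 μ := by
  have hc : Continuous fun u => g u ^ 2 := hg.continuous.pow 2
  rw [memLp_two_iff_integrable_sq hc.aestronglyMeasurable]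
  have h := (memLp_of_lipschitzWith hg μ (p := 4) (by norm_num)).integrable_norm_pow (p := 4)
    (by norm_num)
  refine h.congr (ae_of_all _ fun u => ?_)
  simp only [Real.norm_eq_abs, Even.pow_abs (by decide : Even 4)]
  ring

theorem continuous_xi {φ : ℝ → ℝ} {C : ℝ≥0} (hφ : LipschitzWith C φ) : Continuous (xi φ) := by
  have h : xi φ = fun u => gap φ u + psi φ u ^ 2 := by ext u; simp [gap]
  rw [h]
  exact (lipschitzWith_gap hφ).continuous.add ((lipschitzWith_psi hφ).continuous.pow 2)

theorem integrable_xi {φ : ℝ → ℝ} {C : ℝ≥0} (hφ : LipschitzWith C φ) (μ : Measure ℝ)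
    [IsGaussian μ] : Integrable (xi φ) μ := by
  have h : xi φ = fun u => gap φ u + psi φ u ^ 2 := by ext u; simp [gap]
  rw [h]
  exact ((memLp_of_lipschitzWith (lipschitzWith_gap hφ) μ ENNReal.one_ne_top).integrable le_rfl).add
    ((memLp_sq_of_lipschitzWith (lipschitzWith_psi hφ) μ).integrable one_le_two)

theorem measurable_neuronVariance {φ : ℝ → ℝ} {C : ℝ≥0} (hφ : LipschitzWith C φ) :
    Measurable fun p : ℝ × ℝ => neuronVariance φ p.1 p.2 := by
  have h1 := (continuous_xi hφ).measurable
  have h2 := (lipschitzWith_psi hφ).continuous.measurable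
  unfold neuronVariance
  fun_prop

theorem memLp_neuronVariance {φ : ℝ → ℝ} {C : ℝ≥0} (hφ : LipschitzWith C φ) :
    MemLp (fun p : ℝ × ℝ => neuronVariance φ p.1 p.2) 2
      ((gaussianReal 0 1).prod (gaussianReal 0 1)) := by
  set ρ := (gaussianReal 0 1).prod (gaussianReal 0 1)
  have hψ := memLp_sq_of_lipschitzWith (lipschitzWith_psi hφ) (gaussianReal 0 1)
  have hw : MemLp (fun w : ℝ => w ^ 2) 2 (gaussianReal 0 1) :=
    memLp_sq_of_lipschitzWith LipschitzWith.id (gaussianReal 0 1)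
  have h1 : MemLp (fun p : ℝ × ℝ => psi φ p.2 ^ 2) 2 ρ :=
    hψ.comp_measurePreserving measurePreserving_snd
  have h2 : MemLp (fun p : ℝ × ℝ => p.1 ^ 2) 2 ρ :=
    hw.comp_measurePreserving measurePreserving_fst
  have h3 : MemLp (fun _ : ℝ × ℝ => (1 : ℝ)) 2 ρ := memLp_const 1
  have h4 : MemLp (fun p : ℝ × ℝ => psi φ p.2 ^ 2 + (C : ℝ) ^ 2 * (1 + p.1 ^ 2)) 2 ρ :=
    h1.add ((h3.add h2).const_mul _)
  refine h4.mono (measurable_neuronVariance hφ).aestronglyMeasurable (ae_of_all _ fun p => ?_)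
  have hsplit : neuronVariance φ p.1 p.2 = psi φ p.2 ^ 2 + gap φ p.2 * (1 + p.1 ^ 2) := by
    unfold neuronVariance gap; ring
  have hg := gap_nonneg hφ p.2
  rw [hsplit, Real.norm_of_nonneg (by positivity), Real.norm_of_nonneg (by positivity)]
  gcongr
  exact gap_le hφ p.2

theorem integral_neuronVariance {φ : ℝ → ℝ} {C : ℝ≥0} (hφ : LipschitzWith C φ) :
    ∫ p : ℝ × ℝ, neuronVariance φ p.1 p.2 ∂((gaussianReal 0 1).prod (gaussianReal 0 1))
      = sigmaSq φ := by
  have hw : Integrable (fun w : ℝ => w ^ 2) (gaussianReal 0 1) :=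
    IsGaussian.memLp_two_id.integrable_sq
  have hψ : Integrable (fun u => psi φ u ^ 2) (gaussianReal 0 1) :=
    (memLp_sq_of_lipschitzWith (lipschitzWith_psi hφ) _).integrable one_le_two
  have hw1 : Integrable (fun w : ℝ => 1 + w ^ 2) (gaussianReal 0 1) := (integrable_const 1).add hw
  have hw2 := integral_sq_gaussianReal 0 1
  unfold neuronVariance
  rw [integral_sub (hw1.mul_prod (integrable_xi hφ _)) (hw.mul_prod hψ),
    integral_prod_mul (fun w : ℝ => 1 + w ^ 2) (xi φ),
    integral_prod_mul (fun w : ℝ => w ^ 2) fun u => psi φ u ^ 2,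
    integral_add (integrable_const 1) hw, hw2, sigmaSq]
  norm_num

/-- The weak law of large numbers for the triangular array of the neurons at initialisation: for
each width the neurons are independent and identically distributed, with a law that depends neither
on the width nor on the input. -/
theorem tendstoInMeasure_outputVariance {φ : ℝ → ℝ} {C : ℝ≥0} (hφ : LipschitzWith C φ) {n₀ : ℕ}
    (hn₀ : 0 < n₀) {Ω : Type*} [MeasurableSpace Ω] {μ : Measure Ω} [IsProbabilityMeasure μ]
    {ϑ₀ : (n : ℕ) → Ω → Params n₀ n}
    (hlaw : ∀ n, HasLaw (fun ω i => ϑ₀ n ω i) (Measure.pi fun _ => gaussianReal 0 1) μ)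
    {x : EuclideanSpace ℝ (Fin n₀)} (hx : ‖x‖ = √(n₀ : ℝ)) :
    TendstoInMeasure μ (fun n ω => outputVariance φ (ϑ₀ n ω) x) atTop fun _ => sigmaSq φ := by
  rw [tendstoInMeasure_iff_dist]
  intro δ hδ
  set q : ℝ × ℝ → ℝ := fun p => neuronVariance φ p.1 p.2
  set ρ := (gaussianReal 0 1).prod (gaussianReal 0 1)
  have hqm : Measurable q := measurable_neuronVariance hφ
  have hq2 : MemLp q 2 ρ := memLp_neuronVariance hφ
  have hbound : ∀ n : ℕ, 0 < n → μ {ω | δ ≤ dist (outputVariance φ (ϑ₀ n ω) x) (sigmaSq φ)}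
      ≤ ENNReal.ofReal (Var[q; ρ] / δ ^ 2 / n) := fun n hn => by
    have hn0 : (n : ℝ) ≠ 0 := by positivity
    set P := Measure.pi fun _ : Fin n => ρ
    set F : (Fin n → ℝ × ℝ) → ℝ := fun z => (1 / (n : ℝ)) * ∑ j, q (z j) with hF
    have hFm : Measurable F := by fun_prop
    have hZ := (measurePreserving_neurons (n := n) hn₀ hx 0 1).hasLaw.comp (hlaw n)
    have hh : ∀ j : Fin n, hidden (0 : Idx n₀ n → ℝ) x j = 0 := fun j => by simp [hidden]
    simp only [Pi.zero_apply, hh] at hZ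
    have hcoord : ∀ j, MemLp (fun z : Fin n → ℝ × ℝ => q (z j)) 2 P := fun j =>
      hq2.comp_measurePreserving (measurePreserving_eval (fun _ => ρ) j)
    have hF2 : MemLp F 2 P := (memLp_finsetSum _ fun j _ => hcoord j).const_mul _
    have hmean : ∫ z, F z ∂P = sigmaSq φ := by
      rw [hF, integral_const_mul, integral_finsetSum _ fun j _ => (hcoord j).integrable one_le_two]
      have : ∀ j, ∫ z : Fin n → ℝ × ℝ, q (z j) ∂P = sigmaSq φ := fun j => by
        rw [← integral_neuronVariance hφ]
        exact (measurePreserving_eval (fun _ => ρ) j).hasLaw.integral_comp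
          (f := q) hqm.aestronglyMeasurable
      simp only [this, Finset.sum_const, Finset.card_univ, Fintype.card_fin, nsmul_eq_mul]
      field_simp
    have hvar : Var[F; P] = Var[q; ρ] / n := by
      have h := variance_sum_pi (μ := fun _ : Fin n => ρ) (X := fun _ => q) fun _ => hq2
      have h3 : (∑ j, fun z : Fin n → ℝ × ℝ => q (z j)) = fun z => ∑ j, q (z j) := by
        ext z; simp
      rw [h3] at h
      rw [hF, variance_const_mul, h]
      simp only [Finset.sum_const, Finset.card_univ, Fintype.card_fin, nsmul_eq_mul]
      field_simp
    have hcheb := meas_ge_le_variance_div_sq hF2 hδ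
    rw [hmean, hvar, div_right_comm] at hcheb
    refine le_trans (le_of_eq ?_) hcheb
    have hset : MeasurableSet {z | δ ≤ |F z - sigmaSq φ|} :=
      measurableSet_le measurable_const (hFm.sub_const _).abs
    rw [← hZ.measure_eq hset]
    congr 1
    ext ω
    simp only [Set.mem_ofPred_eq, Real.dist_eq, outputVariance_eq_average hφ hn₀ _ hx]
    rfl
  refine tendsto_of_tendsto_of_tendsto_of_le_of_le' tendsto_const_nhds (h := fun n : ℕ =>
    ENNReal.ofReal (Var[q; ρ] / δ ^ 2 / n)) ?_ (Eventually.of_forall fun _ => zero_le) ?_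
  · have h := ENNReal.tendsto_ofReal (tendsto_const_div_atTop_nhds_zero_nat (Var[q; ρ] / δ ^ 2))
    rwa [ENNReal.ofReal_zero] at h
  · exact (eventually_gt_atTop 0).mono hbound

/-- A tight initial loss keeps the whole trajectory at a distance `O(1)` from the initial point,
with high probability, and the lazy-training estimate applies uniformly in the input and the time.
-/
theorem exists_measure_outputVariance_sub_le {φ : ℝ → ℝ} {C : ℝ≥0} (hφ : LipschitzWith C φ)
    {n₀ : ℕ} (hn₀ : 0 < n₀) {m : ℕ} (hm : 0 < m) {η : ℝ} (hη : 0 < η)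
    {L : (n : ℕ) → Params n₀ n → ℝ} (hL : ∀ n ϑ, 0 ≤ L n ϑ)
    (hmean : ∃ A : ℝ≥0∞, A ≠ ∞ ∧ ∀ᶠ n in atTop, HasInitialMeanLE (L n) A)
    {Ω : Type*} [MeasurableSpace Ω] {μ : Measure Ω}
    {θ : (n : ℕ) → Ω → ℝ → Params n₀ n}
    (hlaw : ∀ n, HasLaw (fun ω i => θ n ω 0 i) (Measure.pi fun _ => gaussianReal 0 1) μ)
    (hflow : ∀ᶠ n in atTop, ∀ᵐ ω ∂μ,
      IsGradientFlow (pacObjective (L n) η m (θ n ω 0)) (θ n ω)) {ε : ℝ≥0∞} (hε : 0 < ε) :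
    ∃ C : ℝ, ∀ᶠ n : ℕ in atTop,
      μ {ω | ∃ x : EuclideanSpace ℝ (Fin n₀), ‖x‖ = √(n₀ : ℝ) ∧ ∃ t : ℝ, 0 ≤ t ∧
        C / √(n : ℝ) < |outputVariance φ (θ n ω t) x - outputVariance φ (θ n ω 0) x|} ≤ ε := by
  obtain ⟨A, hA, hAn⟩ := hmean
  have hε2 : 0 < ε / 2 := ENNReal.half_pos hε.ne'
  obtain ⟨B₁, hB₁⟩ := exists_forall_measure_loss_le hA hε2
  obtain ⟨B₂, hB₂⟩ := exists_forall_measure_sum_pow_four_le n₀ hε2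
  obtain ⟨K, hK, hlazy⟩ := exists_abs_outputVariance_sub_le hφ hn₀
  refine ⟨K * (2 * (2 * η * √(8 * (m : ℝ)) * B₁) + 3 * B₂), ?_⟩
  filter_upwards [hAn, hflow, eventually_gt_atTop 0] with n hn hfl hn0
  have hcoord : ∀ i, HasLaw (fun ω => θ n ω 0 i) (gaussianReal 0 1) μ := fun i =>
    (measurePreserving_eval (fun _ : Idx n₀ n => gaussianReal 0 1) i).hasLaw.comp (hlaw n)
  have h1 := hB₁ μ (fun ω => θ n ω 0) (hlaw n) (L n) hn
  have h2 := hB₂ μ (fun ω => θ n ω 0) hn0 hcoord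
  refine le_trans (measure_mono_ae ?_) ((measure_union_le _ _).trans
    ((add_le_add h1 h2).trans_eq (ENNReal.add_halves ε)))
  filter_upwards [hfl] with ω hω hbad
  by_contra hgood
  change ¬(B₁ < L n (θ n ω 0) ∨ B₂ * n < ∑ i, (1 + θ n ω 0 i ^ 4)) at hgood
  push Not at hgood
  obtain ⟨x, hx, t, ht, hlt⟩ := hbad
  refine absurd (hlazy n (θ n ω t) (θ n ω 0) _ _ hn0 ?_ hgood.2 x hx) (not_le.2 hlt)
  exact (norm_sub_sq_le_of_isGradientFlow hm hη (hL n) hω ht).trans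
    (mul_le_mul_of_nonneg_left hgood.1 (by positivity))

end WideStochasticNet

theorem mainTheorem4
    -- input dimension, sphere of radius `√n₀`, Lipschitz activation
    (n₀ : ℕ) (hn₀ : 0 < n₀)
    (φ : ℝ → ℝ) (Cφ : ℝ≥0) (hφ : LipschitzWith Cφ φ)
    -- non-negative loss with at most exponential growth, labels in `{1, -1}`
    (ℓ : ℝ → ℤˣ → ℝ) (hℓ_meas : ∀ y, Measurable fun u => ℓ u y) (hℓ_nonneg : ∀ u y, 0 ≤ ℓ u y)
    (hℓ_growth : ∃ K κ : ℝ, ∀ u y, ℓ u y ≤ K * Real.exp (κ * |u|))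
    -- training sample, PAC-Bayesian parameter
    (m : ℕ) (hm : 0 < m) (X : Fin m → EuclideanSpace ℝ (Fin n₀)) (Y : Fin m → ℤˣ)
    (hX : ∀ i, ‖X i‖ = √(n₀ : ℝ)) (η : ℝ) (hη : 0 < η)
    -- random initialisation, and training by gradient flow, at each width `n`
    {Ω : Type*} [MeasurableSpace Ω] (μ : Measure Ω) [IsProbabilityMeasure μ]
    (θ : (n : ℕ) → Ω → ℝ → Params n₀ n)
    (hinit_indep : ∀ n, iIndepFun (fun (i : Idx n₀ n) (ω : Ω) => θ n ω 0 i) μ)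
    (hinit_law : ∀ n (i : Idx n₀ n), HasLaw (fun ω => θ n ω 0 i) (gaussianReal 0 1) μ)
    (hflow :
      (∀ᶠ n in atTop, ∀ᵐ ω ∂μ,
        IsGradientFlow (pacObjective (expectedLoss φ ℓ X Y) η m (θ n ω 0)) (θ n ω)) ∨
      (∀ᶠ n in atTop, ∀ᵐ ω ∂μ,
        IsGradientFlow (pacObjective (limitLoss φ ℓ X Y) η m (θ n ω 0)) (θ n ω))) :
    -- the output variance at finite width
    (∀ (n : ℕ) (ϑ : Params n₀ n) (x : EuclideanSpace ℝ (Fin n₀)), ‖x‖ = √(n₀ : ℝ) →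
      outputVariance φ ϑ x =
        (1 / (n : ℝ)) * ∑ j, (1 + ϑ (Sum.inr j) ^ 2) * xi φ (hidden ϑ x j)
          - (1 / (n : ℝ)) * ∑ j, ϑ (Sum.inr j) ^ 2 * psi φ (hidden ϑ x j) ^ 2) ∧
    -- at initialisation it converges in probability to the deterministic constant `σ²`
    (∀ x : EuclideanSpace ℝ (Fin n₀), ‖x‖ = √(n₀ : ℝ) →
      TendstoInMeasure μ (fun n ω => outputVariance φ (θ n ω 0) x) atTop
        (fun _ => sigmaSq φ)) ∧
    -- its variation during the whole training is `O(1/√n)` in probability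
    (∀ ε : ℝ≥0∞, 0 < ε → ∃ C : ℝ, ∀ᶠ n : ℕ in atTop,
      μ {ω | ∃ x : EuclideanSpace ℝ (Fin n₀), ‖x‖ = √(n₀ : ℝ) ∧ ∃ t : ℝ, 0 ≤ t ∧
        C / √(n : ℝ) < |outputVariance φ (θ n ω t) x - outputVariance φ (θ n ω 0) x|} ≤ ε) ∧
    -- hence in the limit it is equal to `σ²` throughout the training
    (∀ x : EuclideanSpace ℝ (Fin n₀), ‖x‖ = √(n₀ : ℝ) → ∀ δ : ℝ, 0 < δ →
      Tendsto (fun n => μ {ω | ∃ t : ℝ, 0 ≤ t ∧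
        δ ≤ |outputVariance φ (θ n ω t) x - sigmaSq φ|}) atTop (𝓝 0)) := by
  have hlaw : ∀ n, HasLaw (fun ω i => θ n ω 0 i) (Measure.pi fun _ => gaussianReal 0 1) μ :=
    fun n => (hinit_indep n).hasLaw_pi (hinit_law n)
  obtain ⟨K, κ, hℓ⟩ := hℓ_growth
  have hinit := fun (x : EuclideanSpace ℝ (Fin n₀)) (hx : ‖x‖ = √(n₀ : ℝ)) =>
    tendstoInMeasure_outputVariance hφ hn₀ hlaw hx
  have hvariation : ∀ ε : ℝ≥0∞, 0 < ε → ∃ C : ℝ, ∀ᶠ n : ℕ in atTop,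
      μ {ω | ∃ x : EuclideanSpace ℝ (Fin n₀), ‖x‖ = √(n₀ : ℝ) ∧ ∃ t : ℝ, 0 ≤ t ∧
        C / √(n : ℝ) < |outputVariance φ (θ n ω t) x - outputVariance φ (θ n ω 0) x|} ≤ ε := by
    intro ε hε
    rcases hflow with hflow | hflow
    · exact exists_measure_outputVariance_sub_le hφ hn₀ hm hη
        (fun _ => expectedLoss_nonneg hℓ_nonneg Y)
        (exists_hasInitialMeanLE_expectedLoss hφ hℓ_nonneg hℓ hn₀ hX Y) hlaw hflow hε
    · exact exists_measure_outputVariance_sub_le hφ hn₀ hm hη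
        (fun _ => limitLoss_nonneg hℓ_nonneg Y)
        (exists_hasInitialMeanLE_limitLoss hφ hℓ_nonneg hℓ hn₀ hX Y) hlaw hflow hε
  refine ⟨fun n ϑ x hx => outputVariance_eq hφ hn₀ ϑ hx, hinit, hvariation, fun x hx δ hδ => ?_⟩
  rw [ENNReal.tendsto_nhds_zero]
  intro ε hε
  have hε2 : 0 < ε / 2 := ENNReal.half_pos hε.ne'
  obtain ⟨C, hC⟩ := hvariation (ε / 2) hε2
  have h0 := ENNReal.tendsto_nhds_zero.1 (tendstoInMeasure_iff_dist.1 (hinit x hx) (δ / 2)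
    (half_pos hδ)) (ε / 2) hε2
  have hsmall : ∀ᶠ n : ℕ in atTop, C / √(n : ℝ) < δ / 2 := by
    have h : Tendsto (fun n : ℕ => C / √(n : ℝ)) atTop (𝓝 0) :=
      tendsto_const_nhds.div_atTop (Real.tendsto_sqrt_atTop.comp tendsto_natCast_atTop_atTop)
    exact h.eventually_lt_const (half_pos hδ)
  filter_upwards [hC, h0, hsmall] with n hCn h0n hn
  refine le_trans (measure_mono ?_) ((measure_union_le _ _).trans
    ((add_le_add h0n hCn).trans_eq (ENNReal.add_halves ε)))
  rintro ω ⟨t, ht, hlt⟩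
  by_cases hclose : δ / 2 ≤ dist (outputVariance φ (θ n ω 0) x) (sigmaSq φ)
  · exact Or.inl hclose
  · refine Or.inr ⟨x, hx, t, ht, hn.trans ?_⟩
    rw [Real.dist_eq, not_le] at hclose
    have := abs_sub_le (outputVariance φ (θ n ω t) x) (outputVariance φ (θ n ω 0) x) (sigmaSq φ)
    linarith
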